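/- Let $H$ be a Hermitian operator on a finite-dimensional complex Hilbert space $\mathcal H$, let $|\psi\rangle\in\mathcal H$ be a unit vector that is not an eigenvector of $H$, and consider the clock states $|\psi_t\rangle=e^{-itH}|\psi\rangle$, $t\in\mathbb R$. A probabilistic $n$-to-$m$ cloner is a completely positive, trace non-increasing linear map $\mathcal C$ from operators on $\mathcal H^{\otimes n}$ to operators on $\mathcal H^{\otimes m}$ whose success probability $p_t=\operatorname{Tr}[\mathcal C(\psi_t^{\otimes n})]$, $\psi_t=|\psi_t\rangle\langle\psi_t|$, is positive for all $t$; its fidelity is the worst-case fidelity conditional on success, $\inf_{t}\operatorname{Tr}[\psi_t^{\otimes m}\,\mathcal C(\psi_t^{\otimes n})]/p_t$. It is optimal if its fidelity is maximal among all probabilistic $n$-to-$m$ cloners. In a divide-and-clone strategy from $N$ to $M$ copies, the $N$ input copies are divided into groups of sizes $n_i$ ($\sum_i n_i=N$), an optimal probabilistic $n_i$-to-$m_i$ cloner $\mathcal C_i$ is applied to group $i$ ($\sum_i m_i=M$), and the fidelity of the strategy is the worst-case fidelity, conditional on success, of $\bigotimes_i\mathcal C_i$ with respect to $\psi_t^{\otimes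 M}$. Its interaction size is $k=\max_i\max(n_i,m_i)$. It has group exponent $\beta$ if, as $N\to\infty$ and uniformly in $i$, $n_i=\Theta(N^\beta)$ and $m_i=\Theta(n_iM/N)$. Then optimal probabilistic $n$-to-$m$ cloners exist for all $n,m$. Moreover, let $\delta\ge 0$ and let $M>N$ with $M-N=\Theta(N^{1+\delta})$, along any sequence of input numbers $N\to\infty$ (so $M/N=\Theta(N^\delta)$). 1. For every sequence of divide-and-clone strategies from $N$ to $M$ copies with some group exponent $\beta\in\mathbb R$, the following are equivalent: (a) the fidelity of the strategy converges to $1$ (superreplication is achieved); (b) the group size grows faster than $N^\delta$, i.e. $\min_i n_i/N^\delta\to\infty$; (c) $\beta>\delta$; (d) the interaction size is large compared to $M^2/N^2$, i.e. $M^2/N^2=o(k)$. 2. If $\delta<1$, then for every $\varepsilon>0$ there is a sequence of divisions into groups, with some group exponent $\beta$ and with interaction size $k=O(M^2/N^{2-\varepsilon})$, for which the fidelity of the divide-and-clone strategy converges to $1$ (for any choice of the optimal cloners). -/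

import Mathlib

open Filter Asymptotics

open scoped Matrix ComplexOrder

namespace Superreplication

noncomputable section

/-! ### States

The Hilbert space of one particle is `ℂ^d` for a finite index type `d`. A register of particles
labelled by a finite type `P` has the Hilbert space `(ℂ^d)^{⊗P}`, whose product basis is indexed by
`P → d`; operators on it are matrices indexed by `P → d`. -/

/-- The clock state `|ψ_t⟩ = exp(-i t H) |ψ⟩`. -/
def clockState {d : Type*} [Fintype d] [DecidableEq d] (H : Matrix d d ℂ) (ψ : d → ℂ) (t : ℝ) :
    d → ℂ :=
  (NormedSpace.exp ((-(Complex.I * (t : ℂ))) • H)) *ᵥ ψ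

/-- The product vector `|φ⟩^{⊗P}` of a register with particles labelled by `P`. -/
def tensorPower {d : Type*} (P : Type*) [Fintype P] (φ : d → ℂ) : (P → d) → ℂ :=
  fun a => ∏ j, φ (a j)

/-- The operator `|v⟩⟨v|`. -/
def ketBra {A : Type*} (v : A → ℂ) : Matrix A A ℂ :=
  Matrix.vecMulVec v (star v)

/-- `|ψ_t⟩⟨ψ_t|^{⊗P}`: one perfect copy of the clock state on each particle of the register. -/
def copies {d : Type*} [Fintype d] [DecidableEq d] (H : Matrix d d ℂ) (ψ : d → ℂ)
    (P : Type*) [Fintype P] (t : ℝ) : Matrix (P → d) (P → d) ℂ :=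
  ketBra (tensorPower P (clockState H ψ t))

/-! ### Quantum operations -/

/-- Complete positivity: applying `E` to every block of a positive semidefinite `k × k` block matrix
(that is, applying `id_k ⊗ E`) gives a positive semidefinite matrix, for every `k`. -/
def IsCompletelyPositive {A B : Type*} [Fintype A] [Fintype B]
    (E : Matrix A A ℂ →ₗ[ℂ] Matrix B B ℂ) : Prop :=
  ∀ (k : ℕ) (X : Matrix (Fin k) (Fin k) (Matrix A A ℂ)),
    (Matrix.comp (Fin k) (Fin k) A A ℂ X).PosSemidef →
      (Matrix.comp (Fin k) (Fin k) B B ℂ (X.map E)).PosSemidef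

/-- `E` does not increase the trace of positive semidefinite operators. -/
def IsTraceNonincreasing {A B : Type*} [Fintype A] [Fintype B]
    (E : Matrix A A ℂ →ₗ[ℂ] Matrix B B ℂ) : Prop :=
  ∀ X : Matrix A A ℂ, X.PosSemidef → (E X).trace.re ≤ X.trace.re

/-- Probability that the operation `E` occurs when its input register `P` holds perfect copies of
`|ψ_t⟩`. -/
def successProb {d : Type*} [Fintype d] [DecidableEq d] (H : Matrix d d ℂ) (ψ : d → ℂ)
    {P Q : Type*} [Fintype P] [DecidableEq P] [Fintype Q] [DecidableEq Q]
    (E : Matrix (P → d) (P → d) ℂ →ₗ[ℂ] Matrix (Q → d) (Q → d) ℂ) (t : ℝ) : ℝ :=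
  (E (copies H ψ P t)).trace.re

/-- Fidelity, conditional on success, between the output of `E` for input `|ψ_t⟩^{⊗P}` and the
perfect copies `|ψ_t⟩^{⊗Q}`. -/
def fidelityAt {d : Type*} [Fintype d] [DecidableEq d] (H : Matrix d d ℂ) (ψ : d → ℂ)
    {P Q : Type*} [Fintype P] [DecidableEq P] [Fintype Q] [DecidableEq Q]
    (E : Matrix (P → d) (P → d) ℂ →ₗ[ℂ] Matrix (Q → d) (Q → d) ℂ) (t : ℝ) : ℝ :=
  (copies H ψ Q t * E (copies H ψ P t)).trace.re / successProb H ψ E t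

/-- Worst-case fidelity over all clock states `|ψ_t⟩`, `t ∈ ℝ`. -/
def fidelity {d : Type*} [Fintype d] [DecidableEq d] (H : Matrix d d ℂ) (ψ : d → ℂ)
    {P Q : Type*} [Fintype P] [DecidableEq P] [Fintype Q] [DecidableEq Q]
    (E : Matrix (P → d) (P → d) ℂ →ₗ[ℂ] Matrix (Q → d) (Q → d) ℂ) : ℝ :=
  ⨅ t : ℝ, fidelityAt H ψ E t

/-- A probabilistic `n`-to-`m` cloner for the clock states: the successful branch of a quantum
instrument. It has a positive success probability on every clock state, so that the state
conditional on success is defined. -/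
structure ProbCloner {d : Type*} [Fintype d] [DecidableEq d] (H : Matrix d d ℂ) (ψ : d → ℂ)
    (n m : ℕ) where
  /-- the successful quantum operation -/
  op : Matrix (Fin n → d) (Fin n → d) ℂ →ₗ[ℂ] Matrix (Fin m → d) (Fin m → d) ℂ
  completelyPositive : IsCompletelyPositive op
  traceNonincreasing : IsTraceNonincreasing op
  successProb_pos : ∀ t : ℝ, 0 < successProb H ψ op t

/-- `C` is an optimal probabilistic `n`-to-`m` cloner: it attains the maximum fidelity. -/
def ProbCloner.IsOptimal {d : Type*} [Fintype d] [DecidableEq d] {H : Matrix d d ℂ} {ψ : d → ℂ}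
    {n m : ℕ} (C : ProbCloner H ψ n m) : Prop :=
  ∀ C' : ProbCloner H ψ n m, fidelity H ψ C'.op ≤ fidelity H ψ C.op

/-! ### Divide-and-clone -/

/-- A division of `N` input copies into groups: group `i` receives `inSize i` of the `N` input
copies and has to produce `outSize i` of the `M` output copies. -/
structure Division (N M : ℕ) where
  /-- number of groups -/
  groups : ℕ
  /-- number of input copies in each group -/
  inSize : Fin groups → ℕ
  /-- number of output copies of each group -/
  outSize : Fin groups → ℕ
  sum_inSize : ∑ i, inSize i = N
  sum_outSize : ∑ i, outSize i = M

/-- The largest number of particles on which the cloner of a single group acts. -/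
def Division.interactionSize {N M : ℕ} (D : Division N M) : ℕ :=
  Finset.univ.sup fun i => max (D.inSize i) (D.outSize i)

/-- The tensor product `⨂ i, E i` of linear maps between operators on registers of `n i` and `m i`
particles: the linear map that sends `⨂ i, |a i⟩⟨a' i|` to `⨂ i, E i (|a i⟩⟨a' i|)` for all basis
vectors. Particle `j` of group `i` is labelled `⟨i, j⟩`. -/
def tensorMap {d : Type*} [Fintype d] [DecidableEq d] {g : ℕ} {n m : Fin g → ℕ}
    (E : ∀ i, Matrix (Fin (n i) → d) (Fin (n i) → d) ℂ →ₗ[ℂ]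
      Matrix (Fin (m i) → d) (Fin (m i) → d) ℂ) :
    Matrix ((Σ i, Fin (n i)) → d) ((Σ i, Fin (n i)) → d) ℂ →ₗ[ℂ]
      Matrix ((Σ i, Fin (m i)) → d) ((Σ i, Fin (m i)) → d) ℂ where
  toFun X := Matrix.of fun b b' => ∑ a, ∑ a', X a a' *
    ∏ i, E i (Matrix.single (fun j => a ⟨i, j⟩) (fun j => a' ⟨i, j⟩) 1)
      (fun j => b ⟨i, j⟩) (fun j => b' ⟨i, j⟩)
  map_add' X Y := by
    ext b b'
    simp [add_mul, Finset.sum_add_distrib]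
  map_smul' c X := by
    ext b b'
    simp [Finset.mul_sum, mul_assoc]

/-- Fidelity of the divide-and-clone strategy that applies the cloner `C i` to group `i`: the
fidelity of the joint operation `⨂ i, C i` with respect to perfect copies on all outputs. It is
conditional on the success of all the group cloners. -/
def divideAndCloneFidelity {d : Type*} [Fintype d] [DecidableEq d] {H : Matrix d d ℂ} {ψ : d → ℂ}
    {N M : ℕ} (D : Division N M) (C : ∀ i, ProbCloner H ψ (D.inSize i) (D.outSize i)) : ℝ :=
  fidelity H ψ (tensorMap fun i => (C i).op)

/-- The divisions `D k` of `N k` copies have groups of `Θ(N^β)` input copies each, and every group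
produces its proportionate share `Θ(n · M / N)` of the output, where `n` is its number of inputs.
The constants are uniform over the groups. -/
def HasGroupExponent {N M : ℕ → ℕ} (D : ∀ k, Division (N k) (M k)) (β : ℝ) : Prop :=
  ∃ c c' : ℝ, 0 < c ∧ 0 < c' ∧ ∀ᶠ k in atTop, ∀ i : Fin (D k).groups,
    c * (N k : ℝ) ^ β ≤ (D k).inSize i ∧ ((D k).inSize i : ℝ) ≤ c' * (N k : ℝ) ^ β ∧
    c * ((D k).inSize i * ((M k : ℝ) / N k)) ≤ (D k).outSize i ∧
    ((D k).outSize i : ℝ) ≤ c' * ((D k).inSize i * ((M k : ℝ) / N k))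

/-- The group size grows faster than `N ^ δ`, uniformly over the groups. -/
def GroupsGrowFasterThan {N M : ℕ → ℕ} (D : ∀ k, Division (N k) (M k)) (δ : ℝ) : Prop :=
  ∀ R : ℝ, ∀ᶠ k in atTop, ∀ i : Fin (D k).groups, R * (N k : ℝ) ^ δ ≤ (D k).inSize i

/-- Along `N → ∞`, the numbers `M` of outputs satisfy `M = N (1 + f)` with `f = Θ(N^δ)`, `f > 0`. -/
def HasReplicationExponent (N M : ℕ → ℕ) (δ : ℝ) : Prop :=
  (∀ᶠ k in atTop, N k < M k) ∧
    (fun k => (M k : ℝ) - N k) =Θ[atTop] fun k => (N k : ℝ) ^ (1 + δ)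

end

end Superreplication

open Superreplication

/-! Time averaging turns cloning into a spectral problem. Averaged over `t`, the success probability
and the fidelity of an operation only see, for each energy shift `μ`, the component that maps every
`n`-particle energy `E` to the `m`-particle energy `E + μ`, and Cauchy–Schwarz bounds the fidelity
by the probability that the energy of `|ψ⟩^{⊗m}` lies in the spectrum of `|ψ⟩^{⊗n}` shifted by `μ`.
A filter that carries the component at `E` to the one at `E + μ` attains this bound, so the optimal
fidelity is the maximum of these probabilities over `μ`.

The spectrum of `n` copies has width of order `n`, while the energy of `m` copies fluctuates on the
scale `√m`. Hence the optimal fidelity tends to `1` exactly when `n² / m → ∞`, and then (Hoeffding)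
the error is exponentially small in `n² / m`, so that it survives multiplication over polynomially
many groups. For `n = Θ(N^β)` and `m = Θ(N^(β+δ))` the ratio `n² / m` is of order `N^(β-δ)`. -/

namespace Superreplication

/-! ### Time averages of trigonometric polynomials -/

/-- `a` is the mean of `f` over the time interval `[0, T]` in the limit `T → ∞`. -/
def HasTimeAverage {E : Type*} [NormedAddCommGroup E] [NormedSpace ℝ E] (f : ℝ → E) (a : E) :
    Prop :=
  Tendsto (fun T : ℝ => T⁻¹ • ∫ t in (0 : ℝ)..T, f t) atTop (nhds a)

namespace HasTimeAverage

variable {E : Type*} [NormedAddCommGroup E] [NormedSpace ℝ E]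

theorem sum {ι : Type*} {s : Finset ι} {f : ι → ℝ → E} {a : ι → E}
    (hf : ∀ i ∈ s, Continuous (f i)) (h : ∀ i ∈ s, HasTimeAverage (f i) (a i)) :
    HasTimeAverage (fun t => ∑ i ∈ s, f i t) (∑ i ∈ s, a i) := by
  refine (tendsto_finsetSum s h).congr fun T => ?_
  rw [intervalIntegral.integral_finsetSum fun i hi => (hf i hi).intervalIntegrable 0 T,
    Finset.smul_sum]

theorem clm_apply {F : Type*} [NormedAddCommGroup F] [NormedSpace ℝ F] [CompleteSpace E]
    [CompleteSpace F] {f : ℝ → E} {a : E} (L : E →L[ℝ] F) (hf : Continuous f)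
    (h : HasTimeAverage f a) : HasTimeAverage (fun t => L (f t)) (L a) := by
  refine ((L.continuous.tendsto a).comp h).congr fun T => ?_
  rw [Function.comp_apply, map_smul,
    L.intervalIntegral_comp_comm (hf.intervalIntegrable 0 T)]

theorem const_mul {𝕜 : Type*} [RCLike 𝕜] {f : ℝ → 𝕜} {a : 𝕜} (c : 𝕜) (h : HasTimeAverage f a) :
    HasTimeAverage (fun t => c * f t) (c * a) := by
  refine (Tendsto.const_mul c h).congr fun T => ?_
  rw [intervalIntegral.integral_const_mul, mul_smul_comm]

theorem le {f g : ℝ → ℝ} {a b : ℝ} (hf : Continuous f) (hg : Continuous g)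
    (ha : HasTimeAverage f a) (hb : HasTimeAverage g b) (hfg : ∀ t, f t ≤ g t) : a ≤ b := by
  refine le_of_tendsto_of_tendsto ha hb ?_
  filter_upwards [eventually_ge_atTop 0] with T hT
  exact smul_le_smul_of_nonneg_left (intervalIntegral.integral_mono_on hT
    (hf.intervalIntegrable 0 T) (hg.intervalIntegrable 0 T) fun t _ => hfg t) (inv_nonneg.2 hT)

end HasTimeAverage

theorem hasTimeAverage_exp (ω : ℝ) :
    HasTimeAverage (fun t : ℝ => Complex.exp (ω * Complex.I * t)) (if ω = 0 then 1 else 0) := by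
  split_ifs with h
  · refine tendsto_const_nhds.congr' ?_
    filter_upwards [eventually_ne_atTop 0] with T hT
    simp [h, hT]
  · have hc : (ω * Complex.I : ℂ) ≠ 0 := by simp [h]
    have hexp (T : ℝ) : ‖Complex.exp (ω * Complex.I * T)‖ = 1 := by simp [Complex.norm_exp]
    simp only [HasTimeAverage, integral_exp_mul_complex hc]
    refine tendsto_inv_atTop_zero.zero_smul_isBoundedUnder_le
      (isBoundedUnder_of ⟨2 / ‖(ω * Complex.I : ℂ)‖, fun T => ?_⟩)
    rw [Function.comp_apply, norm_div]
    gcongr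
    calc _ ≤ ‖Complex.exp (ω * Complex.I * T)‖ + ‖Complex.exp (ω * Complex.I * (0 : ℝ))‖ :=
          norm_sub_le _ _
      _ = 2 := by rw [hexp, hexp]; norm_num

theorem hasTimeAverage_normSq_sum_exp (s : Finset ℝ) (z : ℝ → ℂ) :
    HasTimeAverage (fun t : ℝ => Complex.normSq (∑ ν ∈ s, z ν * Complex.exp (ν * Complex.I * t)))
      (∑ ν ∈ s, Complex.normSq (z ν)) := by
  have hmean : HasTimeAverage (fun t : ℝ => ∑ ν ∈ s, ∑ ν' ∈ s, (z ν * star (z ν')) *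
        Complex.exp ((ν - ν' : ℝ) * Complex.I * t))
      (∑ ν ∈ s, ∑ ν' ∈ s, (z ν * star (z ν')) * if ν - ν' = 0 then 1 else 0) :=
    .sum (fun _ _ => by fun_prop) fun _ _ => .sum (fun _ _ => by fun_prop) fun _ _ =>
      (hasTimeAverage_exp _).const_mul _
  have hexpand (t : ℝ) :
      ((Complex.normSq (∑ ν ∈ s, z ν * Complex.exp (ν * Complex.I * t)) : ℝ) : ℂ) =
        ∑ ν ∈ s, ∑ ν' ∈ s, (z ν * star (z ν')) * Complex.exp ((ν - ν' : ℝ) * Complex.I * t) := by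
    rw [← Complex.mul_conj, map_sum, Finset.sum_mul_sum]
    refine Finset.sum_congr rfl fun ν _ => Finset.sum_congr rfl fun ν' _ => ?_
    simp only [map_mul, ← Complex.exp_conj, Complex.conj_ofReal, Complex.conj_I]
    rw [mul_mul_mul_comm, ← Complex.exp_add]
    congr 2
    push_cast
    ring
  have hdiag : ∑ ν ∈ s, ∑ ν' ∈ s, (z ν * star (z ν')) * (if ν - ν' = 0 then (1 : ℂ) else 0) =
      ((∑ ν ∈ s, Complex.normSq (z ν) : ℝ) : ℂ) := by
    push_cast
    refine Finset.sum_congr rfl fun ν hν => ?_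
    simp [sub_eq_zero, hν, Complex.mul_conj]
  rw [hdiag, ← funext hexpand] at hmean
  exact hmean.clm_apply Complex.reCLM (by fun_prop)

section TrigPoly

variable {ι : Type*} [Fintype ι] (z : ι → ℂ) (ω : ι → ℝ)

/-- The trigonometric polynomial with coefficients `z` and frequencies `ω`, which may repeat. -/
noncomputable def trigPoly (t : ℝ) : ℂ :=
  ∑ i, z i * Complex.exp (ω i * Complex.I * t)

/-- The total coefficient of the frequency `ν` in a trigonometric polynomial. -/
noncomputable def frequencyCoeff (ν : ℝ) : ℂ :=
  ∑ i with ω i = ν, z i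

/-- The sum of the squared moduli of the coefficients of a trigonometric polynomial, after
collecting equal frequencies. -/
noncomputable def spectralMass : ℝ :=
  ∑ ν ∈ Finset.univ.image ω, Complex.normSq (frequencyCoeff z ω ν)

theorem spectralMass_nonneg : 0 ≤ spectralMass z ω :=
  Finset.sum_nonneg fun _ _ => Complex.normSq_nonneg _

@[fun_prop]
theorem continuous_normSq_trigPoly : Continuous fun t => Complex.normSq (trigPoly z ω t) :=
  Complex.continuous_normSq.comp (by unfold trigPoly; fun_prop)

theorem trigPoly_eq_sum_frequencyCoeff (t : ℝ) :
    trigPoly z ω t =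
      ∑ ν ∈ Finset.univ.image ω, frequencyCoeff z ω ν * Complex.exp (ν * Complex.I * t) := by
  rw [trigPoly, ← Finset.sum_fiberwise_of_maps_to (t := Finset.univ.image ω) (g := ω)
    fun i _ => Finset.mem_image_of_mem ω (Finset.mem_univ i)]
  refine Finset.sum_congr rfl fun ν _ => ?_
  rw [frequencyCoeff, Finset.sum_mul]
  exact Finset.sum_congr rfl fun i hi => by rw [(Finset.mem_filter.1 hi).2]

theorem hasTimeAverage_normSq_trigPoly :
    HasTimeAverage (fun t => Complex.normSq (trigPoly z ω t)) (spectralMass z ω) := by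
  simp only [trigPoly_eq_sum_frequencyCoeff]
  exact hasTimeAverage_normSq_sum_exp _ _

theorem trigPoly_eq_zero_of_spectralMass_eq_zero (h : spectralMass z ω = 0) (t : ℝ) :
    trigPoly z ω t = 0 := by
  have hcoeff := (Finset.sum_eq_zero_iff_of_nonneg fun _ _ => Complex.normSq_nonneg _).1 h
  rw [trigPoly_eq_sum_frequencyCoeff]
  exact Finset.sum_eq_zero fun ν hν => by rw [Complex.normSq_eq_zero.1 (hcoeff ν hν), zero_mul]

theorem sum_normSq_frequencyCoeff_le_spectralMass (s : Finset ℝ) :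
    ∑ ν ∈ s, Complex.normSq (frequencyCoeff z ω ν) ≤ spectralMass z ω := by
  have hsupp : ∀ ν ∈ s, Complex.normSq (frequencyCoeff z ω ν) ≠ 0 → ν ∈ Finset.univ.image ω := by
    intro ν _ hν
    obtain ⟨i, hi, -⟩ :=
      Finset.exists_ne_zero_of_sum_ne_zero fun h => hν (Complex.normSq_eq_zero.2 h)
    exact Finset.mem_image.2 ⟨i, Finset.mem_univ i, (Finset.mem_filter.1 hi).2⟩
  rw [← Finset.sum_filter_of_ne hsupp]
  exact Finset.sum_le_sum_of_subset_of_nonneg (fun ν hν => (Finset.mem_filter.1 hν).2)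
    fun _ _ _ => Complex.normSq_nonneg _

end TrigPoly

theorem normSq_sum_mul_le {ι : Type*} (s : Finset ι) (x y : ι → ℂ) :
    Complex.normSq (∑ i ∈ s, x i * y i) ≤
      (∑ i ∈ s, Complex.normSq (x i)) * ∑ i ∈ s, Complex.normSq (y i) := by
  simp only [Complex.normSq_eq_norm_sq]
  calc ‖∑ i ∈ s, x i * y i‖ ^ 2 ≤ (∑ i ∈ s, ‖x i‖ * ‖y i‖) ^ 2 := by
        gcongr
        simpa only [norm_mul] using norm_sum_le s fun i => x i * y i
    _ ≤ _ := Finset.sum_mul_sq_le_sq_mul_sq s (fun i => ‖x i‖) (fun i => ‖y i‖)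

/-! ### The spectral bound on the fidelity -/

/-- Coordinates, in an energy eigenbasis with energies `e`, of a clock state with amplitudes `c`. -/
noncomputable def clockVec {A : Type*} (e : A → ℝ) (c : A → ℂ) (t : ℝ) : A → ℂ :=
  fun a => c a * Complex.exp (-e a * Complex.I * t)

section SpectralOverlap

variable {A B J : Type*} [Fintype A] [Fintype B] [Fintype J]
  (eA : A → ℝ) (cA : A → ℂ) (eB : B → ℝ) (cB : B → ℂ)

/-- The weight that a clock state with energies `eB` and amplitudes `cB` gives to the spectrum of
the clock state with energies `eA` and amplitudes `cA`, shifted by `μ`. -/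
noncomputable def spectralOverlap (μ : ℝ) : ℝ :=
  open Classical in
  ∑ b with ∃ a, cA a ≠ 0 ∧ eB b = eA a + μ, Complex.normSq (cB b)

theorem spectralOverlap_nonneg (μ : ℝ) : 0 ≤ spectralOverlap eA cA eB cB μ :=
  Finset.sum_nonneg fun _ _ => Complex.normSq_nonneg _

theorem finite_range_spectralOverlap : (Set.range (spectralOverlap eA cA eB cB)).Finite := by
  classical
  refine (Set.finite_range fun s : Finset B => ∑ b ∈ s, Complex.normSq (cB b)).subset ?_
  rintro _ ⟨μ, rfl⟩
  exact ⟨_, rfl⟩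

omit [Fintype B] in
theorem mulVec_clockVec_apply (K : Matrix B A ℂ) (b : B) (t : ℝ) :
    (K *ᵥ clockVec eA cA t) b = trigPoly (fun a => K b a * cA a) (fun a => -eA a) t := by
  simp only [Matrix.mulVec, dotProduct, clockVec, trigPoly, mul_assoc, Complex.ofReal_neg]

theorem star_clockVec_dotProduct_mulVec_clockVec (K : Matrix B A ℂ) (t : ℝ) :
    star (clockVec eB cB t) ⬝ᵥ (K *ᵥ clockVec eA cA t) =
      trigPoly (fun p : B × A => star (cB p.1) * (K p.1 p.2 * cA p.2))
        (fun p => eB p.1 - eA p.2) t := by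
  simp only [trigPoly, Fintype.sum_prod_type, dotProduct, mulVec_clockVec_apply, Finset.mul_sum]
  refine Finset.sum_congr rfl fun b _ => Finset.sum_congr rfl fun a _ => ?_
  simp only [Pi.star_apply, clockVec, star_mul', RCLike.star_def, ← Complex.exp_conj, map_mul,
    map_neg, Complex.conj_ofReal, Complex.conj_I]
  rw [mul_mul_mul_comm, ← Complex.exp_add]
  congr 2
  push_cast
  ring

open Classical in
theorem frequencyCoeff_sub_eq_sum (K : Matrix B A ℂ) (ν : ℝ) :
    frequencyCoeff (fun p : B × A => star (cB p.1) * (K p.1 p.2 * cA p.2))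
        (fun p => eB p.1 - eA p.2) ν =
      ∑ b with ∃ a, cA a ≠ 0 ∧ eB b = eA a + ν,
        star (cB b) * frequencyCoeff (fun a => K b a * cA a) (fun a => -eA a) (ν - eB b) := by
  have hcond (b : B) (a : A) : eB b - eA a = ν ↔ -eA a = ν - eB b := by
    constructor <;> intro h <;> linarith
  rw [frequencyCoeff, Finset.sum_filter, Fintype.sum_prod_type, Finset.sum_filter]
  refine Finset.sum_congr rfl fun b _ => ?_
  rw [frequencyCoeff, Finset.mul_sum, ← Finset.sum_filter]
  simp only [hcond]
  split_ifs with h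
  · rfl
  · refine Finset.sum_eq_zero fun a ha => ?_
    have hca : cA a = 0 := by
      by_contra hne
      exact h ⟨a, hne, by linarith [(Finset.mem_filter.1 ha).2]⟩
    rw [hca, mul_zero, mul_zero]

variable {eA cA eB cB}

/- By Cauchy–Schwarz: the output frequency `ν` only involves the energies in the spectrum of the
input, shifted by `ν`. -/
theorem spectralMass_sub_le (K : Matrix B A ℂ) {F : ℝ}
    (hF : ∀ μ, spectralOverlap eA cA eB cB μ ≤ F) :
    spectralMass (fun p : B × A => star (cB p.1) * (K p.1 p.2 * cA p.2))
        (fun p => eB p.1 - eA p.2) ≤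
      F * ∑ b, spectralMass (fun a => K b a * cA a) (fun a => -eA a) := by
  classical
  have hF0 : 0 ≤ F := (spectralOverlap_nonneg eA cA eB cB 0).trans (hF 0)
  set k : B → ℝ → ℂ := fun b => frequencyCoeff (fun a => K b a * cA a) (fun a => -eA a)
  have hcoeff (ν : ℝ) : Complex.normSq (frequencyCoeff
        (fun p : B × A => star (cB p.1) * (K p.1 p.2 * cA p.2)) (fun p => eB p.1 - eA p.2) ν) ≤
      F * ∑ b, Complex.normSq (k b (ν - eB b)) := by
    rw [frequencyCoeff_sub_eq_sum]
    refine (normSq_sum_mul_le _ _ _).trans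
      (mul_le_mul ?_ ?_ (Finset.sum_nonneg fun _ _ => Complex.normSq_nonneg _) hF0)
    · simpa [spectralOverlap] using hF ν
    · exact Finset.sum_le_sum_of_subset_of_nonneg (Finset.filter_subset _ _)
        fun _ _ _ => Complex.normSq_nonneg _
  refine (Finset.sum_le_sum fun ν _ => hcoeff ν).trans ?_
  rw [← Finset.mul_sum, Finset.sum_comm]
  refine mul_le_mul_of_nonneg_left (Finset.sum_le_sum fun b _ => ?_) hF0
  rw [← Finset.sum_image (f := fun ν => Complex.normSq (k b ν)) (g := fun ν => ν - eB b)
    fun _ _ _ _ h => sub_left_injective h]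
  exact sum_normSq_frequencyCoeff_le_spectralMass _ _ _

/- The weights for success and for fidelity are trigonometric polynomials in `t`, and the inequality
between them survives averaging over all times. -/
theorem le_of_forall_kraus_fidelity (K : J → Matrix B A ℂ) {F f : ℝ}
    (hF : ∀ μ, spectralOverlap eA cA eB cB μ ≤ F)
    (hf : ∀ t, f * ∑ j, ∑ b, Complex.normSq ((K j *ᵥ clockVec eA cA t) b) ≤
      ∑ j, Complex.normSq (star (clockVec eB cB t) ⬝ᵥ (K j *ᵥ clockVec eA cA t)))
    {t₀ : ℝ} (hpos : 0 < ∑ j, ∑ b, Complex.normSq ((K j *ᵥ clockVec eA cA t₀) b)) : f ≤ F := by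
  simp only [mulVec_clockVec_apply, star_clockVec_dotProduct_mulVec_clockVec] at hf hpos
  set p : ℝ := ∑ j, ∑ b, spectralMass (fun a => K j b a * cA a) fun a => -eA a with hp
  have hmean : f * p ≤ ∑ j, spectralMass (fun q : B × A => star (cB q.1) * (K j q.1 q.2 * cA q.2))
      fun q => eB q.1 - eA q.2 :=
    HasTimeAverage.le (by fun_prop) (by fun_prop)
      (.const_mul f <| .sum (fun _ _ => by fun_prop) fun _ _ => .sum (fun _ _ => by fun_prop)
        fun _ _ => hasTimeAverage_normSq_trigPoly _ _)
      (.sum (fun _ _ => by fun_prop) fun _ _ => hasTimeAverage_normSq_trigPoly _ _) hf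
  have hle : f * p ≤ F * p := by
    rw [hp, Finset.mul_sum (a := F)]
    exact hmean.trans (Finset.sum_le_sum fun j _ => spectralMass_sub_le (K j) hF)
  have hp0 : 0 < p := by
    have hnonneg := fun j b => spectralMass_nonneg (fun a => K j b a * cA a) fun a => -eA a
    refine (Finset.sum_nonneg fun j _ => Finset.sum_nonneg fun b _ => hnonneg j b).lt_of_ne' ?_
    contrapose! hpos
    refine (Finset.sum_eq_zero fun j hj => Finset.sum_eq_zero fun b hb => ?_).le
    have hj0 := (Finset.sum_eq_zero_iff_of_nonneg fun j _ =>
      Finset.sum_nonneg fun b _ => hnonneg j b).1 hpos j hj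
    have hb0 := (Finset.sum_eq_zero_iff_of_nonneg fun b _ => hnonneg j b).1 hj0 b hb
    rw [trigPoly_eq_zero_of_spectralMass_eq_zero _ _ hb0, map_zero]
  exact le_of_mul_le_mul_right hle hp0

end SpectralOverlap

/-! ### Kraus operators -/

section Kraus

variable {A B : Type*} [Fintype A] [Fintype B]

omit [Fintype B] in
theorem linearMap_apply_eq_sum_single [DecidableEq A] (E : Matrix A A ℂ →ₗ[ℂ] Matrix B B ℂ)
    (X : Matrix A A ℂ) (b b' : B) :
    E X b b' = ∑ a, ∑ a', X a a' * E (Matrix.single a a' 1) b b' := by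
  have hX : X = ∑ a, ∑ a', X a a' • Matrix.single a a' 1 := by
    simpa only [Matrix.smul_single, smul_eq_mul, mul_one] using Matrix.matrix_eq_sum_single X
  conv_lhs => rw [hX]
  simp only [map_sum, map_smul, Matrix.sum_apply, Matrix.smul_apply, smul_eq_mul]

theorem IsCompletelyPositive.choi_posSemidef [DecidableEq A]
    {E : Matrix A A ℂ →ₗ[ℂ] Matrix B B ℂ} (hE : IsCompletelyPositive E) :
    (Matrix.of fun (p q : A × B) => E (Matrix.single p.1 q.1 1) p.2 q.2).PosSemidef := by
  let f := Fintype.equivFin A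
  let X : Matrix (Fin (Fintype.card A)) (Fin (Fintype.card A)) (Matrix A A ℂ) :=
    Matrix.of fun i j => Matrix.single (f.symm i) (f.symm j) 1
  let v : Fin (Fintype.card A) × A → ℂ := fun p => if f.symm p.1 = p.2 then 1 else 0
  have hX : Matrix.comp _ _ A A ℂ X = Matrix.vecMulVec v (star v) := by
    ext ⟨i, a⟩ ⟨j, b⟩
    simp only [X, v, Matrix.comp_apply, Matrix.of_apply, Matrix.vecMulVec_apply,
      Matrix.single_apply, Pi.star_apply]
    split_ifs <;> simp_all
  have hpos := hE _ X (hX ▸ Matrix.posSemidef_vecMulVec_self_star v)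
  convert hpos.submatrix fun p : A × B => (f p.1, p.2)
  ext p q
  simp [X, Matrix.comp_apply]

theorem IsCompletelyPositive.exists_kraus {E : Matrix A A ℂ →ₗ[ℂ] Matrix B B ℂ}
    (hE : IsCompletelyPositive E) :
    ∃ (r : ℕ) (K : Fin r → Matrix B A ℂ), ∀ X, E X = ∑ j, K j * X * (K j)ᴴ := by
  classical
  obtain ⟨r, v, hv⟩ := Matrix.posSemidef_iff_eq_sum_vecMulVec.1 hE.choi_posSemidef
  refine ⟨r, fun j => Matrix.of fun b a => v j (a, b), fun X => ?_⟩
  ext b b'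
  have hchoi (a a' : A) :
      E (Matrix.single a a' 1) b b' = ∑ j, v j (a, b) * star (v j (a', b')) := by
    simpa [Matrix.sum_apply, Matrix.vecMulVec_apply] using congr_fun₂ hv (a, b) (a', b')
  rw [linearMap_apply_eq_sum_single]
  simp only [hchoi, Matrix.sum_apply, Matrix.mul_apply,
    Matrix.of_apply, Matrix.conjTranspose_apply, Finset.mul_sum, Finset.sum_mul]
  rw [Finset.sum_congr rfl fun a _ => Finset.sum_comm, Finset.sum_comm]
  refine Finset.sum_congr rfl fun j _ => ?_
  rw [Finset.sum_comm]
  refine Finset.sum_congr rfl fun a' _ => Finset.sum_congr rfl fun a _ => ?_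
  ring

/-- The quantum operation `X ↦ K X Kᴴ` with the single Kraus operator `K`. -/
def conjMap (K : Matrix B A ℂ) : Matrix A A ℂ →ₗ[ℂ] Matrix B B ℂ where
  toFun X := K * X * Kᴴ
  map_add' X Y := by rw [Matrix.mul_add, Matrix.add_mul]
  map_smul' c X := by rw [Matrix.mul_smul, Matrix.smul_mul, RingHom.id_apply]

omit [Fintype B] in
theorem conjMap_apply (K : Matrix B A ℂ) (X : Matrix A A ℂ) : conjMap K X = K * X * Kᴴ := rfl

theorem isCompletelyPositive_conjMap (K : Matrix B A ℂ) : IsCompletelyPositive (conjMap K) := by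
  intro k X hX
  let L : Matrix (Fin k × B) (Fin k × A) ℂ :=
    Matrix.of fun p q => if p.1 = q.1 then K p.2 q.2 else 0
  have hL : Matrix.comp (Fin k) (Fin k) B B ℂ (X.map (conjMap K)) =
      L * Matrix.comp (Fin k) (Fin k) A A ℂ X * Lᴴ := by
    ext ⟨i, b⟩ ⟨j, b'⟩
    simp [Matrix.comp_apply, conjMap_apply, Matrix.mul_apply, L, Fintype.sum_prod_type,
      apply_ite (star : ℂ → ℂ), ite_mul, mul_ite, Finset.sum_ite_irrel]
  exact hL ▸ hX.mul_mul_conjTranspose_same L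

theorem trace_ketBra (v : A → ℂ) : (ketBra v).trace = ((∑ a, Complex.normSq (v a) : ℝ) : ℂ) := by
  simp [ketBra, Matrix.trace_vecMulVec, dotProduct, Complex.mul_conj]

theorem trace_ketBra_mul_ketBra (u v : A → ℂ) :
    (ketBra u * ketBra v).trace = Complex.normSq (star u ⬝ᵥ v) := by
  rw [ketBra, ketBra, Matrix.vecMulVec_mul_vecMulVec, Matrix.trace_vecMulVec, dotProduct_smul,
    smul_eq_mul, ← Complex.mul_conj]
  simp [dotProduct, mul_comm]

omit [Fintype B] in
theorem mul_ketBra_mul_conjTranspose (v : A → ℂ) (K : Matrix B A ℂ) :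
    K * ketBra v * Kᴴ = ketBra (K *ᵥ v) := by
  simp [ketBra, Matrix.mul_vecMulVec, Matrix.vecMulVec_mul, Matrix.star_mulVec]

theorem sum_normSq_mulVec_le (K : Matrix B A ℂ) (v : A → ℂ) :
    ∑ b, Complex.normSq ((K *ᵥ v) b) ≤
      (∑ b, ∑ a, Complex.normSq (K b a)) * ∑ a, Complex.normSq (v a) := by
  rw [Finset.sum_mul]
  exact Finset.sum_le_sum fun b _ => normSq_sum_mul_le Finset.univ (K b) v

theorem IsCompletelyPositive.exists_trace_ketBra_eq {E : Matrix A A ℂ →ₗ[ℂ] Matrix B B ℂ}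
    (hE : IsCompletelyPositive E) :
    ∃ (r : ℕ) (K : Fin r → Matrix B A ℂ),
      (∀ v, (E (ketBra v)).trace = ((∑ j, ∑ b, Complex.normSq ((K j *ᵥ v) b) : ℝ) : ℂ)) ∧
      ∀ u v, (ketBra u * E (ketBra v)).trace =
        ((∑ j, Complex.normSq (star u ⬝ᵥ (K j *ᵥ v)) : ℝ) : ℂ) := by
  classical
  obtain ⟨r, K, hK⟩ := hE.exists_kraus
  refine ⟨r, K, fun v => ?_, fun u v => ?_⟩
  · simp only [hK, Matrix.trace_sum, mul_ketBra_mul_conjTranspose, trace_ketBra,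
      Complex.ofReal_sum]
  · simp only [hK, Matrix.mul_sum, Matrix.trace_sum, mul_ketBra_mul_conjTranspose,
      trace_ketBra_mul_ketBra, Complex.ofReal_sum]

theorem isTraceNonincreasing_conjMap {K : Matrix B A ℂ}
    (hK : ∑ b, ∑ a, Complex.normSq (K b a) ≤ 1) : IsTraceNonincreasing (conjMap K) := by
  intro X hX
  obtain ⟨r, v, rfl⟩ := Matrix.posSemidef_iff_eq_sum_vecMulVec.1 hX
  change (conjMap K (∑ i, ketBra (v i))).trace.re ≤ (∑ i, ketBra (v i)).trace.re
  simp only [map_sum, conjMap_apply, Matrix.trace_sum, mul_ketBra_mul_conjTranspose,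
    trace_ketBra, ← Complex.ofReal_sum, Complex.ofReal_re]
  refine Finset.sum_le_sum fun i _ => (sum_normSq_mulVec_le K (v i)).trans ?_
  exact mul_le_of_le_one_left (Finset.sum_nonneg fun _ _ => Complex.normSq_nonneg _) hK

theorem exists_isTraceNonincreasing_conjMap_smul (K : Matrix B A ℂ) :
    ∃ z : ℂ, z ≠ 0 ∧ IsTraceNonincreasing (conjMap (z • K)) := by
  set S : ℝ := ∑ b, ∑ a, Complex.normSq (K b a)
  have hS : 0 ≤ S :=
    Finset.sum_nonneg fun b _ => Finset.sum_nonneg fun a _ => Complex.normSq_nonneg _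
  refine ⟨((√(S + 1))⁻¹ : ℝ), by simp [Real.sqrt_ne_zero'.2 (by linarith : 0 < S + 1)],
    isTraceNonincreasing_conjMap ?_⟩
  simp only [Matrix.smul_apply, smul_eq_mul, map_mul, ← Finset.mul_sum, Complex.normSq_ofReal]
  rw [← mul_inv, Real.mul_self_sqrt (by linarith), inv_mul_le_one₀ (by linarith)]
  linarith

end Kraus

/-! ### Tensor products of operations -/

section BlockTensor

variable {d ι : Type*} [Fintype d] [Fintype ι]

/-- The tensor product `⨂ i, X i` of operators between the registers `Q i` and `P i`. Particle `j`
of group `i` is labelled `⟨i, j⟩`. -/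
def blockTensor {d ι : Type*} [Fintype ι] {P Q : ι → Type*}
    (X : ∀ i, Matrix (P i → d) (Q i → d) ℂ) :
    Matrix ((Σ i, P i) → d) ((Σ i, Q i) → d) ℂ :=
  Matrix.of fun a b => ∏ i, X i (fun j => a ⟨i, j⟩) (fun j => b ⟨i, j⟩)

variable [DecidableEq ι] {P Q R : ι → Type*} [∀ i, Fintype (Q i)] [∀ i, DecidableEq (Q i)]

theorem sum_prod_sigma (f : ∀ i, (Q i → d) → ℂ) :
    ∑ a : (Σ i, Q i) → d, ∏ i, f i (fun j => a ⟨i, j⟩) = ∏ i, ∑ a, f i a := by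
  rw [Fintype.prod_sum]
  exact Fintype.sum_equiv (Equiv.piCurry fun _ _ => d) _ _ fun a => rfl

theorem trace_blockTensor (X : ∀ i, Matrix (Q i → d) (Q i → d) ℂ) :
    (blockTensor X).trace = ∏ i, (X i).trace :=
  sum_prod_sigma fun i => (X i).diag

theorem blockTensor_mul_blockTensor (X : ∀ i, Matrix (P i → d) (Q i → d) ℂ)
    (Y : ∀ i, Matrix (Q i → d) (R i → d) ℂ) :
    blockTensor X * blockTensor Y = blockTensor fun i => X i * Y i := by
  ext a c
  simp only [blockTensor, Matrix.mul_apply, Matrix.of_apply, ← sum_prod_sigma,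
    Finset.prod_mul_distrib]

omit [DecidableEq ι] [∀ i, DecidableEq (Q i)] in
theorem copies_sigma [DecidableEq d] (H : Matrix d d ℂ) (ψ : d → ℂ) (t : ℝ) :
    copies H ψ (Σ i, Q i) t = blockTensor fun i => copies H ψ (Q i) t := by
  ext a a'
  simp [blockTensor, copies, ketBra, Matrix.vecMulVec_apply, tensorPower, Fintype.prod_sigma,
    Finset.prod_mul_distrib]

end BlockTensor

section TensorMap

variable {d : Type*} [Fintype d] [DecidableEq d] {g : ℕ} {n m : Fin g → ℕ}
  (E : ∀ i, Matrix (Fin (n i) → d) (Fin (n i) → d) ℂ →ₗ[ℂ]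
    Matrix (Fin (m i) → d) (Fin (m i) → d) ℂ)

theorem tensorMap_blockTensor (X : ∀ i, Matrix (Fin (n i) → d) (Fin (n i) → d) ℂ) :
    tensorMap E (blockTensor X) = blockTensor fun i => E i (X i) := by
  ext b b'
  simp only [tensorMap, blockTensor, LinearMap.coe_mk, AddHom.coe_mk, Matrix.of_apply,
    ← Finset.prod_mul_distrib]
  rw [Finset.prod_congr rfl fun i _ => linearMap_apply_eq_sum_single (E i) (X i) _ _,
    ← sum_prod_sigma]
  refine Finset.sum_congr rfl fun a _ => ?_
  rw [← sum_prod_sigma]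

variable {E}

theorem fidelityAt_tensorMap (H : Matrix d d ℂ) (ψ : d → ℂ)
    (hE : ∀ i, IsCompletelyPositive (E i)) (t : ℝ) :
    fidelityAt H ψ (tensorMap E) t = ∏ i, fidelityAt H ψ (E i) t := by
  choose r K hsucc hfid using fun i => (hE i).exists_trace_ketBra_eq
  simp only [fidelityAt, successProb, copies_sigma, tensorMap_blockTensor,
    blockTensor_mul_blockTensor, trace_blockTensor]
  simp only [copies, hsucc, hfid, ← Complex.ofReal_prod, Complex.ofReal_re,
    Finset.prod_div_distrib]

end TensorMap

/-! ### Clock states in the energy eigenbasis -/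

section Isometry

variable {A B : Type*} [Fintype A] [Fintype B]

theorem sum_normSq_eq_star_dotProduct (v : A → ℂ) :
    ((∑ a, Complex.normSq (v a) : ℝ) : ℂ) = star v ⬝ᵥ v := by
  simp [dotProduct, Complex.normSq_eq_conj_mul_self]

theorem star_mulVec_dotProduct_mulVec_of_isometry [DecidableEq A] {W : Matrix B A ℂ}
    (hW : Wᴴ * W = 1) (u v : A → ℂ) : star (W *ᵥ u) ⬝ᵥ (W *ᵥ v) = star u ⬝ᵥ v := by
  rw [Matrix.star_mulVec, ← Matrix.dotProduct_mulVec, Matrix.mulVec_mulVec, hW, Matrix.one_mulVec]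

theorem sum_normSq_mulVec_of_isometry [DecidableEq A] {W : Matrix B A ℂ} (hW : Wᴴ * W = 1)
    (v : A → ℂ) : ∑ b, Complex.normSq ((W *ᵥ v) b) = ∑ a, Complex.normSq (v a) := by
  refine Complex.ofReal_injective ?_
  rw [sum_normSq_eq_star_dotProduct, sum_normSq_eq_star_dotProduct,
    star_mulVec_dotProduct_mulVec_of_isometry hW]

theorem star_clockVec_dotProduct_clockVec (e : A → ℝ) (c c' : A → ℂ) (t : ℝ) :
    star (clockVec e c t) ⬝ᵥ clockVec e c' t = star c ⬝ᵥ c' := by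
  refine Finset.sum_congr rfl fun a _ => ?_
  have hphase : star (Complex.exp (-e a * Complex.I * t)) * Complex.exp (-e a * Complex.I * t) =
      1 := by
    rw [RCLike.star_def, ← Complex.normSq_eq_conj_mul_self, Complex.normSq_eq_norm_sq,
      Complex.norm_exp]
    simp
  simp only [Pi.star_apply, clockVec, star_mul']
  rw [mul_mul_mul_comm, hphase, mul_one]

theorem sum_normSq_clockVec (e : A → ℝ) (c : A → ℂ) (t : ℝ) :
    ∑ a, Complex.normSq (clockVec e c t a) = ∑ a, Complex.normSq (c a) := by
  refine Complex.ofReal_injective ?_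
  rw [sum_normSq_eq_star_dotProduct, sum_normSq_eq_star_dotProduct,
    star_clockVec_dotProduct_clockVec]

end Isometry

section EnergyAmplitude

variable {d : Type*} [Fintype d] [DecidableEq d] {H : Matrix d d ℂ} (hH : H.IsHermitian)

/-- The unitary matrix whose columns are the energy eigenvectors. -/
noncomputable def energyBasis : Matrix d d ℂ := hH.eigenvectorUnitary

/-- The coordinates of `ψ` in the energy eigenbasis. -/
noncomputable def energyAmplitude (ψ : d → ℂ) : d → ℂ := (energyBasis hH)ᴴ *ᵥ ψ

theorem energyBasis_conjTranspose_mul_self : (energyBasis hH)ᴴ * energyBasis hH = 1 :=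
  Unitary.coe_star_mul_self hH.eigenvectorUnitary

theorem energyBasis_mul_conjTranspose_self : energyBasis hH * (energyBasis hH)ᴴ = 1 :=
  Unitary.coe_mul_star_self hH.eigenvectorUnitary

theorem eq_energyBasis_mul_diagonal_mul :
    H = energyBasis hH * Matrix.diagonal (fun x => (hH.eigenvalues x : ℂ)) *
      (energyBasis hH)ᴴ := by
  conv_lhs => rw [hH.spectral_theorem]
  rw [Unitary.conjStarAlgAut_apply]
  rfl

theorem energyBasis_mulVec_energyAmplitude (ψ : d → ℂ) :
    energyBasis hH *ᵥ energyAmplitude hH ψ = ψ := by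
  rw [energyAmplitude, Matrix.mulVec_mulVec, energyBasis_mul_conjTranspose_self,
    Matrix.one_mulVec]

theorem clockState_eq (ψ : d → ℂ) (t : ℝ) :
    clockState H ψ t =
      energyBasis hH *ᵥ clockVec hH.eigenvalues (energyAmplitude hH ψ) t := by
  set U := energyBasis hH
  have hinv : U⁻¹ = Uᴴ := Matrix.inv_eq_left_inv (energyBasis_conjTranspose_mul_self hH)
  have hunit : IsUnit U := isUnit_iff_exists.2
    ⟨Uᴴ, energyBasis_mul_conjTranspose_self hH, energyBasis_conjTranspose_mul_self hH⟩
  have hdiag : (-(Complex.I * (t : ℂ))) • H =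
      U * Matrix.diagonal (fun x => -hH.eigenvalues x * Complex.I * t) * U⁻¹ := by
    conv_lhs => rw [eq_energyBasis_mul_diagonal_mul hH]
    rw [← Matrix.smul_mul, ← Matrix.mul_smul, ← Matrix.diagonal_smul, hinv]
    congr 3
    ext x
    simp only [Pi.smul_apply, smul_eq_mul]
    ring
  rw [clockState, hdiag, Matrix.exp_conj _ _ hunit, Matrix.exp_diagonal, hinv,
    ← Matrix.mulVec_mulVec, ← Matrix.mulVec_mulVec, ← energyAmplitude]
  congr 1
  ext x
  rw [Matrix.mulVec_diagonal, clockVec, mul_comm, Pi.coe_exp, Complex.exp_eq_exp_ℂ]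

theorem sum_normSq_energyAmplitude {ψ : d → ℂ} (hψ : star ψ ⬝ᵥ ψ = 1) :
    ∑ x, Complex.normSq (energyAmplitude hH ψ x) = 1 := by
  refine Complex.ofReal_injective ?_
  rw [← sum_normSq_mulVec_of_isometry (energyBasis_conjTranspose_mul_self hH),
    energyBasis_mulVec_energyAmplitude, sum_normSq_eq_star_dotProduct, hψ, Complex.ofReal_one]

theorem exists_energyAmplitude_ne_zero {ψ : d → ℂ} (hψ : ψ ≠ 0) :
    ∃ x, energyAmplitude hH ψ x ≠ 0 := by
  by_contra! h
  refine hψ ?_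
  rw [← energyBasis_mulVec_energyAmplitude hH ψ, show energyAmplitude hH ψ = 0 from funext h,
    Matrix.mulVec_zero]

theorem exists_eigenvalues_lt_of_forall_mulVec_ne_smul {ψ : d → ℂ}
    (hclock : ∀ e : ℂ, H *ᵥ ψ ≠ e • ψ) :
    ∃ x y, energyAmplitude hH ψ x ≠ 0 ∧ energyAmplitude hH ψ y ≠ 0 ∧
      hH.eigenvalues x < hH.eigenvalues y := by
  obtain ⟨x, hx⟩ := exists_energyAmplitude_ne_zero hH (ψ := ψ) fun h => hclock 0 (by simp [h])
  by_contra! hcon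
  set c := energyAmplitude hH ψ
  have heig : Matrix.diagonal (fun x => (hH.eigenvalues x : ℂ)) *ᵥ c =
      (hH.eigenvalues x : ℂ) • c := by
    ext y
    rw [Matrix.mulVec_diagonal, Pi.smul_apply, smul_eq_mul]
    rcases eq_or_ne (c y) 0 with hy | hy
    · simp [hy]
    · rw [le_antisymm (hcon x y hx hy) (hcon y x hy hx)]
  refine hclock (hH.eigenvalues x) ?_
  conv_lhs => rw [eq_energyBasis_mul_diagonal_mul hH]
  rw [← Matrix.mulVec_mulVec, ← energyAmplitude, ← Matrix.mulVec_mulVec, heig, Matrix.mulVec_smul,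
    energyBasis_mulVec_energyAmplitude]

end EnergyAmplitude

section Register

variable {d P : Type*} [Fintype P]

/-- The total of the energies of the particles of a register. -/
def totalEnergy (e : d → ℝ) (a : P → d) : ℝ := ∑ j, e (a j)

variable (P) in
/-- The tensor power `U^{⊗P}` of a matrix. -/
def powerMatrix (U : Matrix d d ℂ) : Matrix (P → d) (P → d) ℂ :=
  Matrix.of fun b a => ∏ j, U (b j) (a j)

variable [Fintype d] [DecidableEq P]

theorem powerMatrix_conjTranspose_mul_self [DecidableEq d] {U : Matrix d d ℂ} (hU : Uᴴ * U = 1) :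
    (powerMatrix P U)ᴴ * powerMatrix P U = 1 := by
  have hentry (x y : d) : ∑ z, star (U z x) * U z y = if x = y then 1 else 0 := by
    simpa [Matrix.mul_apply, Matrix.one_apply] using congr_fun₂ hU x y
  ext a a'
  simp only [Matrix.mul_apply, Matrix.conjTranspose_apply, powerMatrix, Matrix.of_apply, star_prod,
    ← Finset.prod_mul_distrib]
  rw [← Fintype.prod_sum fun (j : P) z => star (U z (a j)) * U z (a' j)]
  simp only [hentry, Matrix.one_apply, Finset.prod_ite_zero, Finset.prod_const_one, funext_iff,
    Finset.mem_univ, true_implies]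

theorem tensorPower_mulVec_clockVec (U : Matrix d d ℂ) (e : d → ℝ) (c : d → ℂ) (t : ℝ) :
    tensorPower P (U *ᵥ clockVec e c t) =
      powerMatrix P U *ᵥ clockVec (totalEnergy e) (tensorPower P c) t := by
  ext b
  simp only [tensorPower, Matrix.mulVec, dotProduct]
  rw [Fintype.prod_sum]
  refine Finset.sum_congr rfl fun a _ => ?_
  simp only [powerMatrix, Matrix.of_apply, clockVec, totalEnergy, tensorPower,
    Finset.prod_mul_distrib, ← Complex.exp_sum, Complex.ofReal_sum, Finset.sum_mul,
    Finset.sum_neg_distrib, neg_mul]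

theorem copies_eq [DecidableEq d] {H : Matrix d d ℂ} (hH : H.IsHermitian) (ψ : d → ℂ) (t : ℝ) :
    copies H ψ P t = ketBra (powerMatrix P (energyBasis hH) *ᵥ
      clockVec (totalEnergy hH.eigenvalues) (tensorPower P (energyAmplitude hH ψ)) t) := by
  rw [copies, clockState_eq hH, tensorPower_mulVec_clockVec]

omit [Fintype d] [DecidableEq P] in
theorem normSq_tensorPower (c : d → ℂ) (a : P → d) :
    Complex.normSq (tensorPower P c a) = ∏ j, Complex.normSq (c (a j)) :=
  map_prod _ _ _

theorem sum_normSq_tensorPower {c : d → ℂ} (hc : ∑ x, Complex.normSq (c x) = 1) :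
    ∑ a : P → d, Complex.normSq (tensorPower P c a) = 1 := by
  simp only [normSq_tensorPower]
  rw [← Fintype.prod_sum fun (_ : P) x => Complex.normSq (c x)]
  simp [hc]

end Register

/-! ### Optimal cloners -/

section OptimalFidelity

variable {d : Type*} [Fintype d] (e : d → ℝ) (c : d → ℂ) (n m : ℕ)

/-- The probability that the total energy of `m` particles, measured on a clock state with energies
`e` and amplitudes `c`, differs by `μ` from a value that the total energy of `n` particles can
take. -/
noncomputable def cloneOverlap (μ : ℝ) : ℝ :=
  spectralOverlap (totalEnergy e : (Fin n → d) → ℝ) (tensorPower (Fin n) c)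
    (totalEnergy e : (Fin m → d) → ℝ) (tensorPower (Fin m) c) μ

/-- The largest fidelity of a probabilistic `n`-to-`m` cloner, in terms of the energies `e` and the
amplitudes `c` of the clock state. -/
noncomputable def optimalFidelity : ℝ := ⨆ μ, cloneOverlap e c n m μ

theorem cloneOverlap_le_optimalFidelity (μ : ℝ) :
    cloneOverlap e c n m μ ≤ optimalFidelity e c n m :=
  le_ciSup (finite_range_spectralOverlap _ _ _ _).bddAbove μ

theorem exists_cloneOverlap_eq_optimalFidelity :
    ∃ μ, cloneOverlap e c n m μ = optimalFidelity e c n m :=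
  (Set.range_nonempty _).csSup_mem (finite_range_spectralOverlap _ _ _ _)

variable {c}

theorem optimalFidelity_pos (hc : ∃ x, c x ≠ 0) : 0 < optimalFidelity e c n m := by
  obtain ⟨x, hx⟩ := hc
  have hconst (k : ℕ) : tensorPower (Fin k) c (fun _ => x) ≠ 0 :=
    Finset.prod_ne_zero_iff.2 fun _ _ => hx
  refine lt_of_lt_of_le ?_ (cloneOverlap_le_optimalFidelity e c n m
    (totalEnergy e (fun _ : Fin m => x) - totalEnergy e (fun _ : Fin n => x)))
  exact Finset.sum_pos' (fun _ _ => Complex.normSq_nonneg _) ⟨fun _ => x,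
    Finset.mem_filter.2 ⟨Finset.mem_univ _, fun _ => x, hconst n, by ring⟩,
    Complex.normSq_pos.2 (hconst m)⟩

end OptimalFidelity

section Upper

variable {d : Type*} [Fintype d] [DecidableEq d] {H : Matrix d d ℂ} {ψ : d → ℂ}
  {P Q : Type*} [Fintype P] [DecidableEq P] [Fintype Q] [DecidableEq Q]
  {E : Matrix (P → d) (P → d) ℂ →ₗ[ℂ] Matrix (Q → d) (Q → d) ℂ}

theorem fidelityAt_nonneg (hE : IsCompletelyPositive E) (t : ℝ) : 0 ≤ fidelityAt H ψ E t := by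
  obtain ⟨r, K, hsucc, hfid⟩ := hE.exists_trace_ketBra_eq
  rw [fidelityAt, successProb, copies, copies, hsucc, hfid, Complex.ofReal_re, Complex.ofReal_re]
  exact div_nonneg (Finset.sum_nonneg fun _ _ => Complex.normSq_nonneg _)
    (Finset.sum_nonneg fun _ _ => Finset.sum_nonneg fun _ _ => Complex.normSq_nonneg _)

theorem bddBelow_range_fidelityAt (hE : IsCompletelyPositive E) :
    BddBelow (Set.range (fidelityAt H ψ E)) :=
  ⟨0, by rintro _ ⟨t, rfl⟩; exact fidelityAt_nonneg hE t⟩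

variable (hH : H.IsHermitian)

variable (ψ) in
theorem IsCompletelyPositive.exists_kraus_energyBasis (hE : IsCompletelyPositive E) :
    ∃ (r : ℕ) (K : Fin r → Matrix (Q → d) (P → d) ℂ),
      (∀ t, successProb H ψ E t = ∑ j, ∑ b, Complex.normSq ((K j *ᵥ
        clockVec (totalEnergy hH.eigenvalues) (tensorPower P (energyAmplitude hH ψ)) t) b)) ∧
      ∀ t, (copies H ψ Q t * E (copies H ψ P t)).trace.re = ∑ j, Complex.normSq (star
        (clockVec (totalEnergy hH.eigenvalues) (tensorPower Q (energyAmplitude hH ψ)) t) ⬝ᵥ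
        (K j *ᵥ
          clockVec (totalEnergy hH.eigenvalues) (tensorPower P (energyAmplitude hH ψ)) t)) := by
  obtain ⟨r, K, hsucc, hfid⟩ := hE.exists_trace_ketBra_eq
  set V := powerMatrix P (energyBasis hH)
  set W := powerMatrix Q (energyBasis hH)
  have hW : W * Wᴴ = 1 := mul_eq_one_comm.1
    (powerMatrix_conjTranspose_mul_self (energyBasis_conjTranspose_mul_self hH))
  refine ⟨r, fun j => Wᴴ * K j * V, fun t => ?_, fun t => ?_⟩
  · rw [successProb, copies_eq hH, hsucc, Complex.ofReal_re]
    refine Finset.sum_congr rfl fun j _ => ?_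
    beta_reduce
    rw [Matrix.mul_assoc, ← Matrix.mulVec_mulVec, sum_normSq_mulVec_of_isometry (W := Wᴴ)
      (by rw [Matrix.conjTranspose_conjTranspose, hW]), Matrix.mulVec_mulVec]
  · rw [copies_eq hH, copies_eq hH, hfid, Complex.ofReal_re]
    refine Finset.sum_congr rfl fun j _ => ?_
    rw [Matrix.star_mulVec, ← Matrix.dotProduct_mulVec, Matrix.mulVec_mulVec, Matrix.mulVec_mulVec]

include hH in
theorem fidelityAt_le_one (hψ : star ψ ⬝ᵥ ψ = 1) (hE : IsCompletelyPositive E) (t : ℝ) :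
    fidelityAt H ψ E t ≤ 1 := by
  obtain ⟨r, K, hsucc, hfid⟩ := hE.exists_kraus_energyBasis ψ hH
  rw [fidelityAt, hsucc, hfid]
  refine div_le_one_of_le₀ (Finset.sum_le_sum fun j _ => ?_)
    (Finset.sum_nonneg fun _ _ => Finset.sum_nonneg fun _ _ => Complex.normSq_nonneg _)
  refine (normSq_sum_mul_le _ _ _).trans_eq ?_
  simp only [Pi.star_apply, RCLike.star_def, Complex.normSq_conj]
  rw [sum_normSq_clockVec, sum_normSq_tensorPower (sum_normSq_energyAmplitude hH hψ), one_mul]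

theorem ProbCloner.fidelity_le_optimalFidelity {n m : ℕ} (C : ProbCloner H ψ n m) :
    fidelity H ψ C.op ≤ optimalFidelity hH.eigenvalues (energyAmplitude hH ψ) n m := by
  obtain ⟨r, K, hsucc, hfid⟩ := C.completelyPositive.exists_kraus_energyBasis ψ hH
  refine le_of_forall_kraus_fidelity K (cloneOverlap_le_optimalFidelity _ _ n m) (fun t => ?_)
    (t₀ := 0) (hsucc 0 ▸ C.successProb_pos 0)
  rw [← hsucc, ← hfid, ← le_div_iff₀ (C.successProb_pos t)]
  exact ciInf_le (bddBelow_range_fidelityAt C.completelyPositive) t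

end Upper

section ShiftFilter

variable {A B : Type*} [Fintype A] [Fintype B] (eA : A → ℝ) (cA : A → ℂ) (eB : B → ℝ) (cB : B → ℂ)
  (μ : ℝ)

/-- The amplitudes `cB`, restricted to the energies in the spectrum of the clock state with energies
`eA` and amplitudes `cA`, shifted by `μ`. -/
noncomputable def shiftedAmplitude (b : B) : ℂ :=
  open Classical in
  if ∃ a, cA a ≠ 0 ∧ eB b = eA a + μ then cB b else 0

theorem sum_normSq_shiftedAmplitude :
    ∑ b, Complex.normSq (shiftedAmplitude eA cA eB cB μ b) =
      spectralOverlap eA cA eB cB μ := by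
  simp only [spectralOverlap, shiftedAmplitude, Finset.sum_filter, apply_ite Complex.normSq,
    map_zero]

theorem star_dotProduct_shiftedAmplitude :
    star cB ⬝ᵥ shiftedAmplitude eA cA eB cB μ = spectralOverlap eA cA eB cB μ := by
  simp only [dotProduct, spectralOverlap, shiftedAmplitude, Finset.sum_filter, Complex.ofReal_sum,
    apply_ite Complex.ofReal, Complex.ofReal_zero, mul_ite, mul_zero,
    Complex.normSq_eq_conj_mul_self, Pi.star_apply, RCLike.star_def]

omit [Fintype B] in
theorem exists_mulVec_clockVec_eq_shiftedAmplitude : ∃ S : Matrix B A ℂ, ∀ t,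
    S *ᵥ clockVec eA cA t = Complex.exp (μ * Complex.I * t) •
      clockVec eB (shiftedAmplitude eA cA eB cB μ) t := by
  classical
  refine ⟨Matrix.of fun b => if h : ∃ a, cA a ≠ 0 ∧ eB b = eA a + μ then
    Pi.single h.choose (cB b / cA h.choose) else 0, fun t => ?_⟩
  ext b
  simp only [Matrix.mulVec, Matrix.of_apply, Pi.smul_apply, smul_eq_mul, clockVec,
    shiftedAmplitude]
  split_ifs with h
  · obtain ⟨hca, hb⟩ := h.choose_spec
    rw [single_dotProduct, clockVec, ← mul_assoc, div_mul_cancel₀ _ hca, mul_left_comm,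
      ← Complex.exp_add]
    congr 2
    have hb' : (eB b : ℂ) = eA h.choose + μ := mod_cast hb
    linear_combination Complex.I * t * hb'
  · rw [zero_dotProduct, zero_mul, mul_zero]

end ShiftFilter

section Optimum

variable {d : Type*} [Fintype d] [DecidableEq d] {H : Matrix d d ℂ} {ψ : d → ℂ}

theorem successProb_conjMap {P Q : Type*} [Fintype P] [DecidableEq P] [Fintype Q] [DecidableEq Q]
    (K : Matrix (Q → d) (P → d) ℂ) (t : ℝ) :
    successProb H ψ (conjMap K) t =
      ∑ b, Complex.normSq ((K *ᵥ tensorPower P (clockState H ψ t)) b) := by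
  rw [successProb, copies, conjMap_apply, mul_ketBra_mul_conjTranspose, trace_ketBra,
    Complex.ofReal_re]

theorem fidelityAt_conjMap {P Q : Type*} [Fintype P] [DecidableEq P] [Fintype Q] [DecidableEq Q]
    (K : Matrix (Q → d) (P → d) ℂ) (t : ℝ) :
    fidelityAt H ψ (conjMap K) t = Complex.normSq (star (tensorPower Q (clockState H ψ t)) ⬝ᵥ
      (K *ᵥ tensorPower P (clockState H ψ t))) / successProb H ψ (conjMap K) t := by
  rw [fidelityAt, copies, copies, conjMap_apply, mul_ketBra_mul_conjTranspose,
    trace_ketBra_mul_ketBra, Complex.ofReal_re]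

variable (hH : H.IsHermitian)

theorem exists_probCloner_fidelity_eq_cloneOverlap {n m : ℕ} {μ : ℝ}
    (hμ : 0 < cloneOverlap hH.eigenvalues (energyAmplitude hH ψ) n m μ) :
    ∃ C : ProbCloner H ψ n m,
      fidelity H ψ C.op = cloneOverlap hH.eigenvalues (energyAmplitude hH ψ) n m μ := by
  set F := cloneOverlap hH.eigenvalues (energyAmplitude hH ψ) n m μ with hF
  set V := powerMatrix (Fin n) (energyBasis hH)
  set W := powerMatrix (Fin m) (energyBasis hH)
  have hV : Vᴴ * V = 1 := powerMatrix_conjTranspose_mul_self (energyBasis_conjTranspose_mul_self hH)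
  have hW : Wᴴ * W = 1 := powerMatrix_conjTranspose_mul_self (energyBasis_conjTranspose_mul_self hH)
  obtain ⟨S, hS⟩ := exists_mulVec_clockVec_eq_shiftedAmplitude
    (totalEnergy hH.eigenvalues) (tensorPower (Fin n) (energyAmplitude hH ψ))
    (totalEnergy hH.eigenvalues) (tensorPower (Fin m) (energyAmplitude hH ψ)) μ
  obtain ⟨z, hz, hnoninc⟩ := exists_isTraceNonincreasing_conjMap_smul (W * S * Vᴴ)
  set K := z • (W * S * Vᴴ) with hK
  set q := shiftedAmplitude (totalEnergy hH.eigenvalues)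
    (tensorPower (Fin n) (energyAmplitude hH ψ)) (totalEnergy hH.eigenvalues)
    (tensorPower (Fin m) (energyAmplitude hH ψ)) μ
  have hout (t : ℝ) : K *ᵥ tensorPower (Fin n) (clockState H ψ t) =
      (z * Complex.exp (μ * Complex.I * t)) •
        (W *ᵥ clockVec (totalEnergy hH.eigenvalues) q t) := by
    rw [clockState_eq hH, tensorPower_mulVec_clockVec, hK, Matrix.smul_mulVec,
      Matrix.mulVec_mulVec, Matrix.mul_assoc, hV, Matrix.mul_one, ← Matrix.mulVec_mulVec, hS,
      Matrix.mulVec_smul, smul_smul]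
  have hphase (t : ℝ) :
      Complex.normSq (z * Complex.exp (μ * Complex.I * t)) = Complex.normSq z := by
    simp [Complex.normSq_eq_norm_sq, Complex.norm_exp]
  have hsucc (t : ℝ) : successProb H ψ (conjMap K) t = Complex.normSq z * F := by
    simp only [successProb_conjMap, hout, Pi.smul_apply, smul_eq_mul, map_mul Complex.normSq
      (_ * _), hphase, ← Finset.mul_sum]
    rw [sum_normSq_mulVec_of_isometry hW, sum_normSq_clockVec, sum_normSq_shiftedAmplitude,
      hF, cloneOverlap]
  have hfid (t : ℝ) : fidelityAt H ψ (conjMap K) t = F := by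
    rw [fidelityAt_conjMap, hsucc, hout, dotProduct_smul, smul_eq_mul, map_mul, hphase,
      clockState_eq hH, tensorPower_mulVec_clockVec, star_mulVec_dotProduct_mulVec_of_isometry hW,
      star_clockVec_dotProduct_clockVec, star_dotProduct_shiftedAmplitude, ← cloneOverlap, ← hF,
      Complex.normSq_ofReal, mul_div_mul_left _ _ (Complex.normSq_pos.2 hz).ne',
      mul_self_div_self]
  refine ⟨⟨conjMap K, isCompletelyPositive_conjMap K, hnoninc, fun t => ?_⟩, ?_⟩
  · exact hsucc t ▸ mul_pos (Complex.normSq_pos.2 hz) hμ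
  · simp only [fidelity, hfid, ciInf_const]

theorem exists_probCloner_fidelity_eq_optimalFidelity (hψ : ψ ≠ 0) (n m : ℕ) :
    ∃ C : ProbCloner H ψ n m,
      fidelity H ψ C.op = optimalFidelity hH.eigenvalues (energyAmplitude hH ψ) n m := by
  obtain ⟨μ, hμ⟩ := exists_cloneOverlap_eq_optimalFidelity hH.eigenvalues (energyAmplitude hH ψ) n m
  rw [← hμ]
  refine exists_probCloner_fidelity_eq_cloneOverlap hH (hμ ▸ optimalFidelity_pos _ n m ?_)
  exact exists_energyAmplitude_ne_zero hH hψ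

include hH in
theorem exists_isOptimal (hψ : ψ ≠ 0) (n m : ℕ) : ∃ C : ProbCloner H ψ n m, C.IsOptimal := by
  obtain ⟨C, hC⟩ := exists_probCloner_fidelity_eq_optimalFidelity hH hψ n m
  exact ⟨C, fun C' => hC ▸ C'.fidelity_le_optimalFidelity hH⟩

theorem ProbCloner.IsOptimal.fidelity_eq (hψ : ψ ≠ 0) {n m : ℕ} {C : ProbCloner H ψ n m}
    (hC : C.IsOptimal) :
    fidelity H ψ C.op = optimalFidelity hH.eigenvalues (energyAmplitude hH ψ) n m := by
  obtain ⟨C', hC'⟩ := exists_probCloner_fidelity_eq_optimalFidelity hH hψ n m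
  exact (C.fidelity_le_optimalFidelity hH).antisymm (hC' ▸ hC C')

end Optimum

section DivideAndClone

variable {d : Type*} [Fintype d] [DecidableEq d] {H : Matrix d d ℂ} {ψ : d → ℂ}
  (hH : H.IsHermitian) {N M : ℕ} (D : Division N M)
  (C : ∀ i, ProbCloner H ψ (D.inSize i) (D.outSize i))

theorem fidelityAt_divideAndClone (t : ℝ) :
    fidelityAt H ψ (tensorMap fun i => (C i).op) t = ∏ i, fidelityAt H ψ (C i).op t :=
  fidelityAt_tensorMap H ψ (fun i => (C i).completelyPositive) t

theorem bddBelow_range_fidelityAt_divideAndClone :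
    BddBelow (Set.range (fidelityAt H ψ (tensorMap fun i => (C i).op))) := by
  refine ⟨0, ?_⟩
  rintro _ ⟨t, rfl⟩
  rw [fidelityAt_divideAndClone]
  exact Finset.prod_nonneg fun i _ => fidelityAt_nonneg (C i).completelyPositive t

theorem prod_fidelity_le_divideAndCloneFidelity :
    ∏ i, fidelity H ψ (C i).op ≤ divideAndCloneFidelity D C := by
  refine le_ciInf fun t => ?_
  rw [fidelityAt_divideAndClone]
  exact Finset.prod_le_prod
    (fun i _ => le_ciInf fun t => fidelityAt_nonneg (C i).completelyPositive t)
    fun i _ => ciInf_le (bddBelow_range_fidelityAt (C i).completelyPositive) t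

include hH in
theorem divideAndCloneFidelity_le_fidelity (hψ : star ψ ⬝ᵥ ψ = 1) (i : Fin D.groups) :
    divideAndCloneFidelity D C ≤ fidelity H ψ (C i).op := by
  refine ciInf_mono (bddBelow_range_fidelityAt_divideAndClone D C) fun t => ?_
  have hnonneg (i : Fin D.groups) := fidelityAt_nonneg (H := H) (ψ := ψ) (C i).completelyPositive t
  rw [fidelityAt_divideAndClone, ← Finset.mul_prod_erase _ _ (Finset.mem_univ i)]
  exact mul_le_of_le_one_right (hnonneg i) (Finset.prod_le_one (fun i _ => hnonneg i)
    fun i _ => fidelityAt_le_one hH hψ (C i).completelyPositive t)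

include hH in
theorem divideAndCloneFidelity_le_one (hψ : star ψ ⬝ᵥ ψ = 1) : divideAndCloneFidelity D C ≤ 1 := by
  refine (ciInf_le (bddBelow_range_fidelityAt_divideAndClone D C) 0).trans ?_
  rw [fidelityAt_divideAndClone]
  exact Finset.prod_le_one (fun i _ => fidelityAt_nonneg (C i).completelyPositive 0)
    fun i _ => fidelityAt_le_one hH hψ (C i).completelyPositive 0

end DivideAndClone

/-! ### Sums of independent identically distributed random variables -/

section Deviation

open MeasureTheory ProbabilityTheory

theorem exists_eventually_le_measureReal_sum {Ω : Type*} {mΩ : MeasurableSpace Ω} {P : Measure Ω}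
    [IsProbabilityMeasure P] {X : ℕ → Ω → ℝ} (hX : MemLp (X 0) 2 P) (hvar : Var[X 0; P] ≠ 0)
    (hindep : iIndepFun X P) (hident : ∀ i, IdentDistrib (X i) (X 0) P P) (D : ℝ) :
    ∃ η : ℝ, 0 < η ∧ ∀ᶠ m : ℕ in atTop,
      η ≤ P.real {ω | m * P[X 0] + D * √m ≤ ∑ k ∈ Finset.range m, X k ω} := by
  set γ := gaussianReal 0 Var[X 0; P].toNNReal
  have hγ : γ (Set.Ioi D) ≠ 0 := fun h => by
    simpa using gaussianReal_absolutelyContinuous' 0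
      (Real.toNNReal_pos.2 ((variance_nonneg _ _).lt_of_ne' hvar)).ne' h
  have hclt := (tendstoInDistribution_inv_sqrt_mul_sum_sub HasLaw.id hX hindep hident).tendsto
  have hliminf := ProbabilityMeasure.le_liminf_measure_open_of_tendsto hclt (isOpen_Ioi (a := D))
  simp only [ProbabilityMeasure.coe_mk, Measure.map_id] at hliminf
  refine ⟨(γ (Set.Ioi D)).toReal / 2, half_pos (ENNReal.toReal_pos hγ (measure_ne_top _ _)), ?_⟩
  have hhalf := (ENNReal.half_lt_self hγ (measure_ne_top _ _)).trans_le hliminf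
  filter_upwards [eventually_lt_of_lt_liminf hhalf, eventually_gt_atTop 0] with m hm hm0
  have hs : 0 < √(m : ℝ) := Real.sqrt_pos.2 (mod_cast hm0)
  have hXm (k : ℕ) : AEMeasurable (X k) P := (hident k).aemeasurable_fst
  rw [Measure.map_apply_of_aemeasurable (by fun_prop) measurableSet_Ioi] at hm
  rw [← ENNReal.toReal_ofNat, ← ENNReal.toReal_div]
  refine ENNReal.toReal_mono (measure_ne_top _ _) (hm.le.trans (measure_mono fun ω hω => ?_))
  have hω : D < (√(m : ℝ))⁻¹ * (∑ k ∈ Finset.range m, X k ω - m * P[X 0]) := hω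
  rw [inv_mul_eq_div, lt_div_iff₀ hs] at hω
  exact (lt_sub_iff_add_lt'.1 hω).le

variable {d : Type*} [MeasurableSpace d] [DiscreteMeasurableSpace d]

theorem exists_isProbabilityMeasure_real_singleton_eq [Fintype d] {w : d → ℝ} (hw : ∀ x, 0 ≤ w x)
    (hw1 : ∑ x, w x = 1) :
    ∃ ν : Measure d, IsProbabilityMeasure ν ∧ ∀ x, ν.real {x} = w x := by
  have hsum : ∑ x, ENNReal.ofReal (w x) = 1 := by
    rw [← ENNReal.ofReal_sum_of_nonneg fun x _ => hw x, hw1, ENNReal.ofReal_one]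
  refine ⟨(PMF.ofFintype _ hsum).toMeasure, inferInstance, fun x => ?_⟩
  rw [measureReal_def, PMF.toMeasure_apply_singleton _ _ (measurableSet_singleton x),
    PMF.ofFintype_apply, ENNReal.toReal_ofReal (hw x)]

variable (ν : Measure d) [IsProbabilityMeasure ν]

theorem infinitePi_real_setOf_eq_sum [Fintype d] {m : ℕ} (p : (Fin m → d) → Prop)
    [DecidablePred p] :
    (Measure.infinitePi fun _ : ℕ => ν).real {ω | p fun j => ω j} =
      ∑ a with p a, ∏ j, ν.real {a j} := by
  have hmap : (Measure.infinitePi fun _ : ℕ => ν).map (fun ω (j : Fin m) => ω j) =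
      Measure.pi fun _ => ν := by
    rw [Measure.map_infinitePi_infinitePi_of_inj Fin.val_injective, Measure.infinitePi_eq_pi]
  have hset : MeasurableSet {a : Fin m → d | p a} := Set.to_countable _ |>.measurableSet
  rw [show {ω : ℕ → d | p fun j => ω j} = (fun ω (j : Fin m) => ω j) ⁻¹' {a | p a} from rfl,
    ← map_measureReal_apply (by fun_prop) hset, hmap, ← Finset.coe_filter_univ,
    ← sum_measureReal_singleton]
  refine Finset.sum_congr rfl fun a _ => ?_
  simp only [measureReal_def, Measure.pi_singleton, ENNReal.toReal_prod]

theorem infinitePi_real_pi_range_singleton (m : ℕ) (x : d) :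
    (Measure.infinitePi fun _ : ℕ => ν).real (Set.pi (Finset.range m) fun _ => {x}) =
      ν.real {x} ^ m := by
  rw [measureReal_def, Measure.infinitePi_pi _ fun _ _ => measurableSet_singleton x]
  simp [measureReal_def]

theorem identDistrib_comp_eval_infinitePi (f : d → ℝ) (k : ℕ) :
    IdentDistrib (fun ω => f (ω k)) f (Measure.infinitePi fun _ : ℕ => ν) ν := by
  have hf : Measurable f := .of_discrete
  refine ⟨(hf.comp (measurable_pi_apply k)).aemeasurable, hf.aemeasurable, ?_⟩
  conv_rhs => rw [← (measurePreserving_eval_infinitePi (fun _ : ℕ => ν) k).map_eq,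
    Measure.map_map hf (measurable_pi_apply k)]
  rfl

theorem exists_eventually_le_infinitePi_real_sum [Finite d] {f : d → ℝ} (hf : Var[f; ν] ≠ 0)
    (D : ℝ) : ∃ η : ℝ, 0 < η ∧ ∀ᶠ m : ℕ in atTop, η ≤ (Measure.infinitePi fun _ : ℕ => ν).real
      {ω | m * ν[f] + D * √m ≤ ∑ k ∈ Finset.range m, f (ω k)} := by
  have hident := identDistrib_comp_eval_infinitePi ν f
  rw [← (hident 0).variance_eq] at hf
  rw [← (hident 0).integral_eq]
  have hindep : iIndepFun (fun (k : ℕ) (ω : ℕ → d) => f (ω k))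
      (Measure.infinitePi fun _ : ℕ => ν) :=
    iIndepFun_infinitePi (X := fun _ => f) fun _ => .of_discrete
  have hmem : MemLp (fun ω : ℕ → d => f (ω 0)) 2 (Measure.infinitePi fun _ => ν) :=
    (hident 0).memLp_iff.2 .of_discrete
  exact exists_eventually_le_measureReal_sum (P := Measure.infinitePi fun _ : ℕ => ν)
    (X := fun k ω => f (ω k)) hmem hf hindep
    (fun k => (hident k).trans (hident 0).symm) D

theorem infinitePi_real_le_sum_sub_le_exp {f : d → ℝ} {a b : ℝ} (hf : ∀ x, f x ∈ Set.Icc a b)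
    (m : ℕ) {ε : ℝ} (hε : 0 ≤ ε) :
    (Measure.infinitePi fun _ : ℕ => ν).real
        {ω | ε ≤ ∑ k ∈ Finset.range m, (f (ω k) - ν[f])} ≤
      Real.exp (-ε ^ 2 / (2 * m * ((b - a) / 2) ^ 2)) := by
  have hindep : iIndepFun (fun (k : ℕ) (ω : ℕ → d) => f (ω k) - ν[f])
      (Measure.infinitePi fun _ : ℕ => ν) :=
    iIndepFun_infinitePi (X := fun _ x => f x - ν[f]) fun _ => .of_discrete
  refine (HasSubgaussianMGF.measure_sum_range_ge_le_of_iIndepFun hindep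
    (c := (‖b - a‖₊ / 2) ^ 2) (fun k _ => ?_) hε).trans_eq (by simp [div_pow])
  rw [← (identDistrib_comp_eval_infinitePi ν f k).integral_eq]
  exact hasSubgaussianMGF_of_mem_Icc
    (identDistrib_comp_eval_infinitePi ν f k).aemeasurable_fst (ae_of_all _ fun ω => hf (ω k))

end Deviation

section EnergyDistribution

open MeasureTheory ProbabilityTheory

variable {d : Type*} [Fintype d] {e : d → ℝ} {c : d → ℂ}

omit [Fintype d] in
theorem totalEnergy_mem_Icc {lo hi : ℝ} (he : ∀ x, c x ≠ 0 → e x ∈ Set.Icc lo hi) {n : ℕ}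
    {a : Fin n → d} (ha : tensorPower (Fin n) c a ≠ 0) :
    totalEnergy e a ∈ Set.Icc (n * lo) (n * hi) := by
  have hea (j : Fin n) : e (a j) ∈ Set.Icc lo hi :=
    he _ (Finset.prod_ne_zero_iff.1 ha j (Finset.mem_univ j))
  constructor
  · simpa [totalEnergy] using Finset.card_nsmul_le_sum Finset.univ _ lo fun j _ => (hea j).1
  · simpa [totalEnergy] using Finset.sum_le_card_nsmul Finset.univ _ hi fun j _ => (hea j).2

variable [MeasurableSpace d] [DiscreteMeasurableSpace d] {ν : Measure d} [IsProbabilityMeasure ν]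
  (hν : ∀ x, ν.real {x} = Complex.normSq (c x))

include hν

variable (e) in
theorem cloneOverlap_eq_measureReal (n m : ℕ) (μ : ℝ) :
    cloneOverlap e c n m μ = (Measure.infinitePi fun _ : ℕ => ν).real
      {ω | ∃ a : Fin n → d, tensorPower (Fin n) c a ≠ 0 ∧
        ∑ k ∈ Finset.range m, e (ω k) = totalEnergy e a + μ} := by
  classical
  have h := infinitePi_real_setOf_eq_sum ν fun b : Fin m → d => ∃ a : Fin n → d,
    tensorPower (Fin n) c a ≠ 0 ∧ totalEnergy e b = totalEnergy e a + μ
  simp only [hν, ← normSq_tensorPower] at h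
  simp only [← Fin.sum_univ_eq_sum_range fun _ => e _]
  exact (Finset.sum_congr (by congr) fun _ _ => rfl).trans h.symm

theorem optimalFidelity_le_one_sub {lo hi : ℝ} (he : ∀ x, c x ≠ 0 → e x ∈ Set.Icc lo hi)
    {n m : ℕ} {T₁ T₂ η : ℝ} (hT : n * (hi - lo) < T₂ - T₁)
    (h₁ : η ≤ (Measure.infinitePi fun _ : ℕ => ν).real
      {ω | ∑ k ∈ Finset.range m, e (ω k) ≤ T₁})
    (h₂ : η ≤ (Measure.infinitePi fun _ : ℕ => ν).real
      {ω | T₂ ≤ ∑ k ∈ Finset.range m, e (ω k)}) :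
    optimalFidelity e c n m ≤ 1 - η := by
  have hmeas : Measurable fun ω : ℕ → d => ∑ k ∈ Finset.range m, e (ω k) :=
    Finset.measurable_sum _ fun k _ => Measurable.of_discrete.comp (measurable_pi_apply k)
  refine ciSup_le fun μ => ?_
  rw [cloneOverlap_eq_measureReal e hν]
  rcases lt_or_ge (n * hi + μ) T₂ with hμ | hμ
  · refine le_trans (measureReal_mono ?_) ((probReal_compl_eq_one_sub
      (measurableSet_le measurable_const hmeas)).trans_le (sub_le_sub_left h₂ 1))
    rintro ω ⟨a, ha, hω⟩ (hT₂ : T₂ ≤ _)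
    linarith [(totalEnergy_mem_Icc he ha).2]
  · refine le_trans (measureReal_mono ?_) ((probReal_compl_eq_one_sub
      (measurableSet_le hmeas measurable_const)).trans_le (sub_le_sub_left h₁ 1))
    rintro ω ⟨a, ha, hω⟩ (hT₁ : _ ≤ T₁)
    linarith [(totalEnergy_mem_Icc he ha).1]

theorem optimalFidelity_le_one_sub_pow {x y : d}
    (he : ∀ z, c z ≠ 0 → e z ∈ Set.Icc (e x) (e y)) (hxy : e x < e y) {p : ℝ} (hp : 0 ≤ p)
    (hpx : p ≤ Complex.normSq (c x)) (hpy : p ≤ Complex.normSq (c y)) {n m : ℕ} (hnm : n < m) :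
    optimalFidelity e c n m ≤ 1 - p ^ m := by
  have hsum {z : d} {ω : ℕ → d} (hω : ω ∈ Set.pi (Finset.range m) fun _ => {z}) :
      ∑ k ∈ Finset.range m, e (ω k) = m * e z := by
    rw [Finset.sum_congr rfl fun k hk => by rw [hω k hk], Finset.sum_const, Finset.card_range,
      nsmul_eq_mul]
  have hprob {z : d} (hz : p ≤ Complex.normSq (c z)) :
      p ^ m ≤ (Measure.infinitePi fun _ : ℕ => ν).real (Set.pi (Finset.range m) fun _ => {z}) := by
    rw [infinitePi_real_pi_range_singleton, hν]
    exact pow_le_pow_left₀ hp hz m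
  refine optimalFidelity_le_one_sub hν he (T₁ := m * e x) (T₂ := m * e y) ?_
    ((hprob hpx).trans (measureReal_mono fun ω hω => (hsum hω).le))
    ((hprob hpy).trans (measureReal_mono fun ω hω => (hsum hω).ge))
  rw [← mul_sub]
  exact mul_lt_mul_of_pos_right (mod_cast hnm) (sub_pos.2 hxy)

omit [Fintype d] in
theorem variance_ne_zero [Finite d] {x y : d} (hx : c x ≠ 0) (hy : c y ≠ 0) (hxy : e x ≠ e y) :
    Var[e; ν] ≠ 0 := fun h => by
  have hae := ae_eq_integral_of_variance_eq_zero MemLp.of_discrete h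
  have hmean {z : d} (hz : c z ≠ 0) : e z = ν[e] := by
    by_contra hne
    refine hz (Complex.normSq_eq_zero.1 (hν z ▸ ?_))
    rw [measureReal_def, measure_mono_null (Set.singleton_subset_iff.2 hne) hae,
      ENNReal.toReal_zero]
  exact hxy ((hmean hx).trans (hmean hy).symm)

theorem exists_eventually_optimalFidelity_le {x y : d}
    (he : ∀ z, c z ≠ 0 → e z ∈ Set.Icc (e x) (e y)) (hx : c x ≠ 0) (hy : c y ≠ 0)
    (hxy : e x < e y) (R : ℝ) :
    ∃ η : ℝ, 0 < η ∧ ∀ᶠ m : ℕ in atTop, ∀ n : ℕ, (n : ℝ) ^ 2 ≤ R * m →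
      optimalFidelity e c n m ≤ 1 - η := by
  set D := √R * (e y - e x) + 1
  have hvar : Var[e; ν] ≠ 0 := variance_ne_zero hν hx hy hxy.ne
  obtain ⟨η₁, hη₁, h₁⟩ := exists_eventually_le_infinitePi_real_sum ν
    (f := -e) (by rwa [variance_neg]) D
  obtain ⟨η₂, hη₂, h₂⟩ := exists_eventually_le_infinitePi_real_sum ν hvar D
  refine ⟨min η₁ η₂, lt_min hη₁ hη₂, ?_⟩
  filter_upwards [h₁, h₂, eventually_gt_atTop 0] with m h₁ h₂ hm n hR
  have hlow : η₁ ≤ (Measure.infinitePi fun _ : ℕ => ν).real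
      {ω | ∑ k ∈ Finset.range m, e (ω k) ≤ m * ν[e] - D * √m} := by
    refine h₁.trans_eq (congrArg _ (Set.ext fun ω => ?_))
    simp only [Set.mem_ofPred_eq, Pi.neg_apply, Finset.sum_neg_distrib, integral_neg]
    constructor <;> intro h <;> linarith
  refine optimalFidelity_le_one_sub hν he ?_ ((min_le_left _ _).trans hlow)
    ((min_le_right _ _).trans h₂)
  have hn : (n : ℝ) ≤ √R * √m := by
    rw [← Real.sqrt_mul' R (Nat.cast_nonneg m)]
    exact Real.le_sqrt_of_sq_le hR
  have hs : 0 < √(m : ℝ) := Real.sqrt_pos.2 (mod_cast hm)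
  have hD : 0 < D * √m := mul_pos (by have := sub_pos.2 hxy; positivity) hs
  calc n * (e y - e x) ≤ √R * √m * (e y - e x) :=
        mul_le_mul_of_nonneg_right hn (sub_pos.2 hxy).le
    _ < D * √m := by linarith
    _ < m * ν[e] + D * √m - (m * ν[e] - D * √m) := by linarith

end EnergyDistribution

section UpperBound

variable {d : Type*} [Fintype d] {e : d → ℝ} {c : d → ℂ}

omit [Fintype d] in
theorem exists_extremal_energies [Finite d] (hne : ∃ x y, c x ≠ 0 ∧ c y ≠ 0 ∧ e x < e y) :
    ∃ x y, c x ≠ 0 ∧ c y ≠ 0 ∧ e x < e y ∧ ∀ z, c z ≠ 0 → e z ∈ Set.Icc (e x) (e y) := by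
  obtain ⟨x₀, y₀, hx₀, hy₀, hxy⟩ := hne
  have hfin : {x | c x ≠ 0}.Finite := Set.toFinite _
  obtain ⟨x, hx, hmin⟩ := Set.exists_min_image _ e hfin ⟨x₀, hx₀⟩
  obtain ⟨y, hy, hmax⟩ := Set.exists_max_image _ e hfin ⟨x₀, hx₀⟩
  exact ⟨x, y, hx, hy, (hmin x₀ hx₀).trans_lt (hxy.trans_le (hmax y₀ hy₀)),
    fun z hz => ⟨hmin z hz, hmax z hz⟩⟩

theorem exists_optimalFidelity_le_one_sub (hc : ∑ x, Complex.normSq (c x) = 1)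
    (hne : ∃ x y, c x ≠ 0 ∧ c y ≠ 0 ∧ e x < e y) (R : ℝ) :
    ∃ η : ℝ, 0 < η ∧ ∀ n m : ℕ, n < m → (n : ℝ) ^ 2 ≤ R * m →
      optimalFidelity e c n m ≤ 1 - η := by
  let _ : MeasurableSpace d := ⊤
  obtain ⟨ν, _, hν⟩ :=
    exists_isProbabilityMeasure_real_singleton_eq (fun x => Complex.normSq_nonneg (c x)) hc
  obtain ⟨x, y, hx, hy, hxy, he⟩ := exists_extremal_energies hne
  obtain ⟨η, hη, hlarge⟩ := exists_eventually_optimalFidelity_le hν he hx hy hxy R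
  obtain ⟨m₀, hm₀⟩ := eventually_atTop.1 hlarge
  set p := min (Complex.normSq (c x)) (Complex.normSq (c y))
  have hp : 0 < p := lt_min (Complex.normSq_pos.2 hx) (Complex.normSq_pos.2 hy)
  have hp1 : p ≤ 1 := (min_le_left _ _).trans <| hc ▸ Finset.single_le_sum
    (f := fun x => Complex.normSq (c x)) (fun x _ => Complex.normSq_nonneg _) (Finset.mem_univ x)
  refine ⟨min η (p ^ m₀), lt_min hη (pow_pos hp _), fun n m hnm hR => ?_⟩
  rcases le_total m₀ m with hm | hm
  · exact (hm₀ m hm n hR).trans (sub_le_sub_left (min_le_left _ _) 1)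
  · refine (optimalFidelity_le_one_sub_pow hν he hxy hp.le (min_le_left _ _) (min_le_right _ _)
      hnm).trans (sub_le_sub_left ((min_le_right _ _).trans ?_) 1)
    exact pow_le_pow_of_le_one hp.le hp1 hm

end UpperBound

section LowerBound

variable {d : Type*} [Fintype d] {e : d → ℝ} {c : d → ℂ}

open Classical in
/-- The occupation number of the level `x`: how many of the first `m` particles of the configuration
`ω` are in this level. -/
noncomputable def occupation {d : Type*} (m : ℕ) (ω : ℕ → d) (x : d) : ℕ :=
  ((Finset.range m).filter fun k => ω k = x).card

theorem sum_comp_eq_sum_occupation_mul (f : d → ℝ) (m : ℕ) (ω : ℕ → d) :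
    ∑ k ∈ Finset.range m, f (ω k) = ∑ x, occupation m ω x * f x := by
  classical
  rw [← Finset.sum_fiberwise _ ω]
  refine Finset.sum_congr rfl fun x _ => ?_
  rw [Finset.sum_congr rfl fun k hk => by rw [(Finset.mem_filter.1 hk).2], Finset.sum_const,
    nsmul_eq_mul, occupation]

theorem sum_occupation (m : ℕ) (ω : ℕ → d) : ∑ x, occupation m ω x = m := by
  have h := sum_comp_eq_sum_occupation_mul (fun _ => 1) m ω
  simp only [Finset.sum_const, Finset.card_range, nsmul_eq_mul, mul_one] at h
  exact_mod_cast h.symm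

omit [Fintype d] in
theorem occupation_eq_zero {m : ℕ} {ω : ℕ → d} {x : d} (hω : ∀ k, ω k ≠ x) :
    occupation m ω x = 0 := by
  classical
  exact Finset.card_eq_zero.2 (Finset.filter_eq_empty_iff.2 fun k _ => hω k)

variable (e) in
theorem exists_totalEnergy_eq_sum_mul (k : d → ℕ) {n : ℕ} (hk : ∑ x, k x = n) :
    ∃ a : Fin n → d, (∀ j, k (a j) ≠ 0) ∧ totalEnergy e a = ∑ x, k x * e x := by
  have hcard : Fintype.card (Fin n) = Fintype.card (Σ x, Fin (k x)) := by simp [hk]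
  let E := Fintype.equivOfCardEq hcard
  refine ⟨fun j => (E j).1, fun j h => (Fin.cast h (E j).2).elim0, ?_⟩
  rw [totalEnergy, Equiv.sum_comp E (fun p => e p.1), Fintype.sum_sigma]
  simp

variable (e) in
theorem exists_totalEnergy_add_eq {k : d → ℕ} {s : d → ℤ} {n : ℕ} (hs : ∀ x, s x ≤ k x)
    (hn : (n : ℤ) + ∑ x, s x = ∑ x, (k x : ℤ)) (hc : ∀ x, c x = 0 → s x = k x) :
    ∃ a : Fin n → d, tensorPower (Fin n) c a ≠ 0 ∧
      totalEnergy e a + ∑ x, s x * e x = ∑ x, k x * e x := by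
  lift fun x => k x - s x to d → ℕ using fun x => sub_nonneg.2 (hs x) with r hr
  replace hr (x : d) : (r x : ℤ) = k x - s x := congrFun hr x
  obtain ⟨a, ha, hea⟩ := exists_totalEnergy_eq_sum_mul e r (n := n) <| by
    zify
    simp only [hr, Finset.sum_sub_distrib, ← hn, add_sub_cancel_right]
  refine ⟨a, Finset.prod_ne_zero_iff.2 fun j _ h => ha j ?_, ?_⟩
  · zify
    rw [hr, hc _ h, sub_self]
  · have hrR (x : d) : (r x : ℝ) = k x - s x := mod_cast congrArg (Int.cast (R := ℝ)) (hr x)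
    rw [hea, ← Finset.sum_add_distrib]
    exact Finset.sum_congr rfl fun x _ => by rw [hrR]; ring

theorem exists_int_sum_eq_of_sum_eq_one {w : d → ℝ} (hw : ∑ x, w x = 1) (z : ℤ) :
    ∃ s : d → ℤ, ∑ x, s x = z ∧ (∀ x, w x = 0 → s x = 0) ∧
      ∀ x, (s x : ℝ) ≤ w x * z + Fintype.card d := by
  classical
  obtain ⟨x₀, -, hx₀⟩ := Finset.exists_ne_zero_of_sum_ne_zero (hw ▸ one_ne_zero)
  set t := ∑ x ∈ Finset.univ.erase x₀, ⌊w x * z⌋ with ht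
  refine ⟨Function.update (fun x => ⌊w x * z⌋) x₀ (z - t), ?_, fun x hx => ?_, fun x => ?_⟩
  · rw [Finset.sum_update_of_mem (Finset.mem_univ _), Finset.sdiff_singleton_eq_erase, ← ht,
      sub_add_cancel]
  · rw [Function.update_of_ne (by rintro rfl; exact hx₀ hx), hx, zero_mul, Int.floor_zero]
  · rcases eq_or_ne x x₀ with rfl | hx
    · have hfloor : ∑ y ∈ Finset.univ.erase x, w y * z ≤ t + (Finset.univ.erase x).card := by
        rw [ht, Finset.cast_card, Int.cast_sum, ← Finset.sum_add_distrib]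
        exact Finset.sum_le_sum fun y _ => (Int.lt_floor_add_one _).le
      have hcard : ((Finset.univ.erase x).card : ℝ) ≤ Fintype.card d :=
        mod_cast Finset.card_le_univ _
      rw [← Finset.sum_mul, Finset.sum_erase_eq_sub (Finset.mem_univ x), hw] at hfloor
      rw [Function.update_self, Int.cast_sub]
      linarith
    · rw [Function.update_of_ne hx]
      exact (Int.floor_le _).trans (le_add_of_nonneg_right (Nat.cast_nonneg _))

variable (e) in
theorem exists_shift_of_occupation (hc : ∑ x, Complex.normSq (c x) = 1) {p : ℝ}
    (hpc : ∀ x, c x ≠ 0 → p ≤ Complex.normSq (c x)) {n : ℕ}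
    (hn : Fintype.card d ≤ p * n / 2) (m : ℕ) :
    ∃ μ : ℝ, ∀ ω : ℕ → d, (∀ k, c (ω k) ≠ 0) →
      (∀ x, m * Complex.normSq (c x) - occupation m ω x < p * n / 2) →
      ∃ a : Fin n → d, tensorPower (Fin n) c a ≠ 0 ∧
        ∑ k ∈ Finset.range m, e (ω k) = totalEnergy e a + μ := by
  -- Fix `m - n` particles with `s x` of them in level `x`, close to the expected proportions. A
  -- typical configuration contains them, and removing them leaves `n` particles.
  obtain ⟨s, hsum, hs0, hs⟩ := exists_int_sum_eq_of_sum_eq_one hc (m - n)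
  refine ⟨∑ x, s x * e x, fun ω hω hdev => ?_⟩
  have hs0 (x : d) (hx : c x = 0) : s x = 0 := hs0 x (Complex.normSq_eq_zero.2 hx)
  have hocc (x : d) (hx : c x = 0) : occupation m ω x = 0 :=
    occupation_eq_zero fun k h => hω k (h ▸ hx)
  have hle (x : d) : s x ≤ occupation m ω x := by
    by_cases hx : c x = 0
    · exact (hs0 x hx).trans_le (Nat.cast_nonneg _)
    · have hpn := mul_le_mul_of_nonneg_right (hpc x hx) (Nat.cast_nonneg n)
      have hsx := hs x
      push_cast at hsx
      exact_mod_cast (by linarith [hdev x] : (s x : ℝ) ≤ occupation m ω x)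
  obtain ⟨a, ha, hea⟩ := exists_totalEnergy_add_eq e (n := n) (c := c) hle
    (by rw [hsum, ← Nat.cast_sum, sum_occupation]; ring)
    (fun x hx => by rw [hs0 x hx, hocc x hx, Nat.cast_zero])
  exact ⟨a, ha, (sum_comp_eq_sum_occupation_mul e m ω).trans hea.symm⟩

open MeasureTheory ProbabilityTheory

theorem infinitePi_real_le_mul_sub_occupation_le_exp {d : Type*} [MeasurableSpace d]
    [DiscreteMeasurableSpace d] (ν : Measure d) [IsProbabilityMeasure ν] (x : d) (m : ℕ) {ε : ℝ}
    (hε : 0 ≤ ε) :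
    (Measure.infinitePi fun _ : ℕ => ν).real {ω | ε ≤ m * ν.real {x} - occupation m ω x} ≤
      Real.exp (-(2 * ε ^ 2 / m)) := by
  classical
  set f : d → ℝ := fun y => -if y = x then 1 else 0 with hf
  have hmem (y : d) : f y ∈ Set.Icc (-1 : ℝ) 0 := by
    by_cases h : y = x <;> simp [f, h]
  have hmean : ν[f] = -ν.real {x} := by
    rw [hf, integral_neg, ← integral_indicator_one (measurableSet_singleton x)]
    simp only [Set.indicator_apply, Set.mem_singleton_iff, Pi.one_apply]
  have hsum (ω : ℕ → d) : ∑ k ∈ Finset.range m, (f (ω k) - ν[f]) =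
      m * ν.real {x} - occupation m ω x := by
    rw [Finset.sum_sub_distrib, hmean, hf, Finset.sum_neg_distrib, Finset.sum_boole,
      Finset.sum_const, Finset.card_range, nsmul_eq_mul, mul_neg, sub_neg_eq_add, neg_add_eq_sub,
      occupation]
  simp only [← hsum]
  refine (infinitePi_real_le_sum_sub_le_exp ν hmem m hε).trans_eq (congrArg _ ?_)
  ring

variable [MeasurableSpace d] [DiscreteMeasurableSpace d] {ν : Measure d} [IsProbabilityMeasure ν]
  (hν : ∀ x, ν.real {x} = Complex.normSq (c x))

include hν

omit [Fintype d] [DiscreteMeasurableSpace d] in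
theorem ae_infinitePi_amplitude_ne_zero [Countable d] :
    ∀ᵐ ω ∂(Measure.infinitePi fun _ : ℕ => ν), ∀ k, c (ω k) ≠ 0 := by
  have hone : ∀ᵐ x ∂ν, c x ≠ 0 := ae_iff_of_countable.2 fun x hx h => hx <| by
    rw [← measureReal_eq_zero_iff, hν, h, map_zero]
  exact ae_all_iff.2 fun k =>
    (measurePreserving_eval_infinitePi (fun _ : ℕ => ν) k).quasiMeasurePreserving.ae hone

variable (e) in
theorem le_optimalFidelity {p : ℝ} (hp : 0 ≤ p) (hpc : ∀ x, c x ≠ 0 → p ≤ Complex.normSq (c x))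
    {n : ℕ} (hn : Fintype.card d ≤ p * n / 2) (m : ℕ) :
    1 - Fintype.card d * Real.exp (-(p ^ 2 / 2 * (n ^ 2 / m))) ≤ optimalFidelity e c n m := by
  set P := Measure.infinitePi fun _ : ℕ => ν
  set dev : d → Set (ℕ → d) := fun x => {ω | p * n / 2 ≤ m * ν.real {x} - occupation m ω x}
  have hc : ∑ x, Complex.normSq (c x) = 1 := by
    simp only [← hν, sum_measureReal_singleton, Finset.coe_univ, probReal_univ]
  obtain ⟨μ, hμ⟩ := exists_shift_of_occupation e hc hpc hn m
  set good : Set (ℕ → d) := {ω | ∃ a : Fin n → d, tensorPower (Fin n) c a ≠ 0 ∧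
    ∑ k ∈ Finset.range m, e (ω k) = totalEnergy e a + μ}
  have hcover : ((⋃ x, dev x) ∪ good : Set (ℕ → d)) =ᵐ[P] Set.univ := by
    refine eventuallyEq_univ.2 ?_
    filter_upwards [ae_infinitePi_amplitude_ne_zero hν] with ω hω
    refine or_iff_not_imp_left.2 fun hdev => hμ ω hω fun x => not_le.1 fun h => hdev ?_
    rw [← hν] at h
    exact Set.mem_iUnion.2 ⟨x, h⟩
  have hdev (x : d) : P.real (dev x) ≤ Real.exp (-(p ^ 2 / 2 * (n ^ 2 / m))) :=
    (infinitePi_real_le_mul_sub_occupation_le_exp ν x m (by positivity)).trans_eq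
      (congrArg _ (by ring))
  rw [sub_le_iff_le_add']
  calc 1 = P.real ((⋃ x, dev x) ∪ good) := by rw [measureReal_congr hcover, probReal_univ]
    _ ≤ P.real (⋃ x, dev x) + P.real good := measureReal_union_le _ _
    _ ≤ ∑ x, P.real (dev x) + P.real good := by gcongr; exact measureReal_iUnion_fintype_le _
    _ ≤ Fintype.card d * Real.exp (-(p ^ 2 / 2 * (n ^ 2 / m))) + optimalFidelity e c n m := by
      refine add_le_add ?_ ?_
      · simpa using Finset.sum_le_card_nsmul Finset.univ _ _ fun x _ => hdev x
      · exact (cloneOverlap_eq_measureReal e hν n m μ).ge.trans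
          (cloneOverlap_le_optimalFidelity e c n m μ)

omit [MeasurableSpace d] [DiscreteMeasurableSpace d] [IsProbabilityMeasure ν] hν

variable (e) in
theorem exists_le_optimalFidelity (hc : ∑ x, Complex.normSq (c x) = 1) :
    ∃ κ : ℝ, 0 < κ ∧ ∃ n₀ : ℕ, ∀ n m : ℕ, n₀ ≤ n →
      1 - Fintype.card d * Real.exp (-(κ * (n ^ 2 / m))) ≤ optimalFidelity e c n m := by
  let _ : MeasurableSpace d := ⊤
  obtain ⟨ν, _, hν⟩ :=
    exists_isProbabilityMeasure_real_singleton_eq (fun x => Complex.normSq_nonneg (c x)) hc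
  obtain ⟨x, -, hx⟩ := Finset.exists_ne_zero_of_sum_ne_zero (hc ▸ one_ne_zero)
  obtain ⟨y, hy, hmin⟩ := Set.exists_min_image {x | c x ≠ 0} (fun x => Complex.normSq (c x))
    (Set.toFinite _) ⟨x, fun h => hx (Complex.normSq_eq_zero.2 h)⟩
  have hp : 0 < Complex.normSq (c y) := Complex.normSq_pos.2 hy
  obtain ⟨n₀, hn₀⟩ := exists_nat_ge (2 * Fintype.card d / Complex.normSq (c y))
  refine ⟨Complex.normSq (c y) ^ 2 / 2, by positivity, n₀, fun n m hn =>
    le_optimalFidelity e hν hp.le hmin ?_ m⟩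
  rw [div_le_iff₀' hp] at hn₀
  rw [le_div_iff₀' two_pos]
  exact hn₀.trans (by gcongr)

end LowerBound

/-! ### Growth rates -/

section Growth

variable {α : Type*} {l : Filter α} {f g u : α → ℝ} {p q : ℝ}

theorem isTheta_iff_exists_bounds (hf : 0 ≤ᶠ[l] f) (hg : 0 ≤ᶠ[l] g) :
    f =Θ[l] g ↔ ∃ a b : ℝ, 0 < a ∧ 0 < b ∧ ∀ᶠ k in l, a * g k ≤ f k ∧ f k ≤ b * g k := by
  have hnorm : ∀ᶠ k in l, ‖f k‖ = f k ∧ ‖g k‖ = g k := by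
    filter_upwards [hf, hg] with k hfk hgk
    exact ⟨Real.norm_of_nonneg hfk, Real.norm_of_nonneg hgk⟩
  constructor
  · rintro ⟨hfg, hgf⟩
    obtain ⟨b, hb, hfg⟩ := hfg.exists_pos
    obtain ⟨a, ha, hgf⟩ := hgf.exists_pos
    refine ⟨a⁻¹, b, inv_pos.2 ha, hb, ?_⟩
    filter_upwards [hnorm, hfg.bound, hgf.bound] with k ⟨hfk, hgk⟩ hupper hlower
    rw [hfk, hgk] at hupper hlower
    exact ⟨(inv_mul_le_iff₀ ha).2 hlower, hupper⟩
  · rintro ⟨a, b, ha, -, hab⟩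
    constructor
    · refine IsBigO.of_bound b ?_
      filter_upwards [hnorm, hab] with k ⟨hfk, hgk⟩ hk
      rw [hfk, hgk]
      exact hk.2
    · refine IsBigO.of_bound a⁻¹ ?_
      filter_upwards [hnorm, hab] with k ⟨hfk, hgk⟩ hk
      rw [hfk, hgk]
      exact (le_inv_mul_iff₀ ha).2 hk.1

theorem rpow_isBigO_rpow (hu : Tendsto u l atTop) (hpq : p ≤ q) :
    (fun k => u k ^ p) =O[l] fun k => u k ^ q := by
  refine IsBigO.of_bound' ?_
  filter_upwards [hu.eventually_ge_atTop 1] with k hk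
  rw [Real.norm_of_nonneg (by positivity), Real.norm_of_nonneg (by positivity)]
  exact Real.rpow_le_rpow_of_exponent_le hk hpq

theorem rpow_isLittleO_rpow_iff [l.NeBot] (hu : Tendsto u l atTop) :
    ((fun k => u k ^ p) =o[l] fun k => u k ^ q) ↔ p < q := by
  refine ⟨fun h => ?_, fun hpq => ?_⟩
  · by_contra! hqp
    refine isLittleO_irrefl (Eventually.frequently ?_) (h.trans_isBigO (rpow_isBigO_rpow hu hqp))
    filter_upwards [hu.eventually_gt_atTop 0] with k hk
    exact (Real.rpow_pos_of_pos hk _).ne'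
  · refine isLittleO_of_tendsto' ?_ (((tendsto_rpow_neg_atTop (sub_pos.2 hpq)).comp hu).congr' ?_)
    · filter_upwards [hu.eventually_gt_atTop 0] with k hk hzero
      exact absurd hzero (Real.rpow_pos_of_pos hk _).ne'
    · filter_upwards [hu.eventually_gt_atTop 0] with k hk
      rw [Function.comp_apply, neg_sub, Real.rpow_sub hk]

theorem tendsto_rpow_mul_exp_neg_mul_rpow (hu : Tendsto u l atTop) (p : ℝ) {A s : ℝ} (hA : 0 < A)
    (hs : 0 < s) :
    Tendsto (fun k => u k ^ p * Real.exp (-(A * u k ^ s))) l (nhds 0) := by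
  refine ((tendsto_rpow_mul_exp_neg_mul_atTop_nhds_zero (p / s) A hA).comp
    ((tendsto_rpow_atTop hs).comp hu)).congr' ?_
  filter_upwards [hu.eventually_ge_atTop 0] with k hk
  rw [Function.comp_apply, Function.comp_apply, ← Real.rpow_mul hk, mul_div_cancel₀ _ hs.ne',
    neg_mul]

end Growth

/-! ### Group sizes -/

section Sizes

theorem Division.nonempty_groups {N M : ℕ} (D : Division N M) (hN : 0 < N) :
    Nonempty (Fin D.groups) := by
  by_contra! hempty
  have hsum := D.sum_inSize
  rw [Finset.univ_eq_empty, Finset.sum_empty] at hsum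
  exact hN.ne hsum

theorem Division.exists_inSize_lt_outSize {N M : ℕ} (D : Division N M) (h : N < M) :
    ∃ i, D.inSize i < D.outSize i := by
  obtain ⟨i, -, hi⟩ := Finset.exists_lt_of_sum_lt (D.sum_inSize.trans_lt (h.trans_eq
    D.sum_outSize.symm))
  exact ⟨i, hi⟩

theorem Division.outSize_le_interactionSize {N M : ℕ} (D : Division N M) (i : Fin D.groups) :
    D.outSize i ≤ D.interactionSize :=
  (le_max_right _ _).trans
    (Finset.le_sup (f := fun i => max (D.inSize i) (D.outSize i)) (Finset.mem_univ i))

theorem Division.interactionSize_le {N M : ℕ} {D : Division N M} {B : ℝ} (hB : 0 ≤ B)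
    (hin : ∀ i, D.inSize i ≤ B) (hout : ∀ i, D.outSize i ≤ B) : D.interactionSize ≤ B := by
  refine (Nat.le_floor_iff hB).1 (Finset.sup_le fun i _ => ?_)
  exact max_le (Nat.le_floor (hin i)) (Nat.le_floor (hout i))

variable {N M : ℕ → ℕ} {β δ : ℝ}

theorem HasReplicationExponent.div_isTheta (hδ : 0 ≤ δ) (hN : Tendsto N atTop atTop)
    (hrep : HasReplicationExponent N M δ) :
    (fun k => (M k : ℝ) / N k) =Θ[atTop] fun k => (N k : ℝ) ^ δ := by
  have hN' : Tendsto (fun k => (N k : ℝ)) atTop atTop := tendsto_natCast_atTop_atTop.comp hN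
  have hexcess : (fun k => ((M k : ℝ) - N k) / N k) =Θ[atTop] fun k => (N k : ℝ) ^ δ := by
    refine (hrep.2.div (isTheta_refl (fun k => (N k : ℝ)) _)).trans_eventuallyEq ?_
    filter_upwards [hN'.eventually_gt_atTop 0] with k hk
    rw [Real.rpow_add hk, Real.rpow_one, mul_div_cancel_left₀ _ hk.ne']
  refine ⟨((rpow_isBigO_rpow hN' hδ).add hexcess.1).congr' ?_ .rfl, hexcess.2.trans ?_⟩
  · filter_upwards [hN'.eventually_gt_atTop 0] with k hk
    rw [Real.rpow_zero]
    field_simp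
    ring
  · refine IsBigO.of_bound' ?_
    filter_upwards [hrep.1] with k hk
    have hNM : (N k : ℝ) ≤ M k := by exact_mod_cast hk.le
    rw [Real.norm_of_nonneg (div_nonneg (sub_nonneg.2 hNM) (Nat.cast_nonneg _)),
      Real.norm_of_nonneg (by positivity)]
    gcongr
    exact sub_le_self _ (Nat.cast_nonneg _)

theorem HasReplicationExponent.sq_div_sq_isTheta (hδ : 0 ≤ δ) (hN : Tendsto N atTop atTop)
    (hrep : HasReplicationExponent N M δ) :
    (fun k => (M k : ℝ) ^ 2 / (N k : ℝ) ^ 2) =Θ[atTop] fun k => (N k : ℝ) ^ (2 * δ) := by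
  have hpow (k : ℕ) : (N k : ℝ) ^ (2 * δ) = ((N k : ℝ) ^ δ) ^ 2 := by
    rw [mul_comm, ← Real.rpow_mul_natCast (Nat.cast_nonneg _), Nat.cast_ofNat]
  simpa only [hpow, div_pow] using (hrep.div_isTheta hδ hN).pow 2

variable {D : ∀ k, Division (N k) (M k)}

theorem HasGroupExponent.groupsGrowFasterThan_of_lt (hN : Tendsto N atTop atTop)
    (hD : HasGroupExponent D β) (h : δ < β) : GroupsGrowFasterThan D δ := by
  have hN' : Tendsto (fun k => (N k : ℝ)) atTop atTop := tendsto_natCast_atTop_atTop.comp hN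
  obtain ⟨a, _, ha, _, hD⟩ := hD
  intro R
  filter_upwards [hD, hN'.eventually_gt_atTop 0,
    ((tendsto_rpow_atTop (sub_pos.2 h)).comp hN').eventually_ge_atTop (R / a)] with k hD hk hR i
  calc R * (N k : ℝ) ^ δ ≤ a * (N k : ℝ) ^ (β - δ) * (N k : ℝ) ^ δ := by
        gcongr
        exact (div_le_iff₀' ha).1 hR
    _ = a * (N k : ℝ) ^ β := by rw [mul_assoc, ← Real.rpow_add hk, sub_add_cancel]
    _ ≤ (D k).inSize i := (hD i).1

theorem HasGroupExponent.lt_of_groupsGrowFasterThan (hN : Tendsto N atTop atTop)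
    (hD : HasGroupExponent D β) (h : GroupsGrowFasterThan D δ) : δ < β := by
  obtain ⟨_, b, _, hb, hD⟩ := hD
  by_contra! hβδ
  obtain ⟨k, hD, hgrow, hk⟩ := (hD.and ((h (b + 1)).and (hN.eventually_ge_atTop 1))).exists
  obtain ⟨i⟩ := (D k).nonempty_groups hk
  have hk' : (1 : ℝ) ≤ N k := by exact_mod_cast hk
  refine lt_irrefl ((D k).inSize i : ℝ) ?_
  calc ((D k).inSize i : ℝ) ≤ b * (N k : ℝ) ^ β := (hD i).2.1
    _ ≤ b * (N k : ℝ) ^ δ := by gcongr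
    _ < (b + 1) * (N k : ℝ) ^ δ := by gcongr; exact lt_add_one b
    _ ≤ (D k).inSize i := hgrow i

theorem HasGroupExponent.exists_outSize_bounds (hδ : 0 ≤ δ) (hN : Tendsto N atTop atTop)
    (hrep : HasReplicationExponent N M δ) (hD : HasGroupExponent D β) :
    ∃ a b : ℝ, 0 < a ∧ 0 < b ∧ ∀ᶠ k in atTop, ∀ i : Fin (D k).groups,
      a * (N k : ℝ) ^ (β + δ) ≤ (D k).outSize i ∧
        ((D k).outSize i : ℝ) ≤ b * (N k : ℝ) ^ (β + δ) := by
  obtain ⟨r, R, hr, hR, hratio⟩ := (isTheta_iff_exists_bounds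
    (.of_forall fun k => by positivity) (.of_forall fun k => by positivity)).1
    (hrep.div_isTheta hδ hN)
  obtain ⟨a, b, ha, hb, hD⟩ := hD
  refine ⟨a * (a * r), b * (b * R), by positivity, by positivity, ?_⟩
  filter_upwards [hratio, hD, hN.eventually_gt_atTop 0] with k ⟨hlower, hupper⟩ hD hk i
  rw [Real.rpow_add (Nat.cast_pos.2 hk)]
  obtain ⟨hin, hin', hout, hout'⟩ := hD i
  constructor
  · calc a * (a * r) * ((N k : ℝ) ^ β * (N k : ℝ) ^ δ)
        = a * ((a * (N k : ℝ) ^ β) * (r * (N k : ℝ) ^ δ)) := by ring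
      _ ≤ a * ((D k).inSize i * ((M k : ℝ) / N k)) := by gcongr
      _ ≤ (D k).outSize i := hout
  · calc ((D k).outSize i : ℝ) ≤ b * ((D k).inSize i * ((M k : ℝ) / N k)) := hout'
      _ ≤ b * ((b * (N k : ℝ) ^ β) * (R * (N k : ℝ) ^ δ)) := by gcongr
      _ = b * (b * R) * ((N k : ℝ) ^ β * (N k : ℝ) ^ δ) := by ring

theorem HasGroupExponent.exists_inSize_sq_div_outSize_bounds (hδ : 0 ≤ δ)
    (hN : Tendsto N atTop atTop) (hrep : HasReplicationExponent N M δ)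
    (hD : HasGroupExponent D β) :
    ∃ a b : ℝ, 0 < a ∧ 0 < b ∧ ∀ᶠ k in atTop, ∀ i : Fin (D k).groups,
      a * (N k : ℝ) ^ (β - δ) ≤ ((D k).inSize i : ℝ) ^ 2 / (D k).outSize i ∧
        ((D k).inSize i : ℝ) ^ 2 / (D k).outSize i ≤ b * (N k : ℝ) ^ (β - δ) := by
  obtain ⟨r, R, hr, hR, hout⟩ := hD.exists_outSize_bounds hδ hN hrep
  obtain ⟨a, b, ha, hb, hD⟩ := hD
  refine ⟨a ^ 2 / R, b ^ 2 / r, by positivity, by positivity, ?_⟩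
  filter_upwards [hout, hD, hN.eventually_gt_atTop 0] with k hout hD hk i
  have hk' : (0 : ℝ) < N k := Nat.cast_pos.2 hk
  have hsq (s t : ℝ) : s ^ 2 / t * (N k : ℝ) ^ (β - δ) =
      (s * (N k : ℝ) ^ β) ^ 2 / (t * (N k : ℝ) ^ (β + δ)) := by
    rw [Real.rpow_add hk', Real.rpow_sub hk']
    field_simp
  obtain ⟨hin, hin', -⟩ := hD i
  have hpos : (0 : ℝ) < (D k).outSize i := lt_of_lt_of_le (by positivity) (hout i).1
  rw [hsq, hsq]
  constructor
  · gcongr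
    exact (hout i).2
  · gcongr
    exact (hout i).1

theorem HasGroupExponent.interactionSize_isTheta (hδ : 0 ≤ δ) (hN : Tendsto N atTop atTop)
    (hrep : HasReplicationExponent N M δ) (hD : HasGroupExponent D β) :
    (fun k => ((D k).interactionSize : ℝ)) =Θ[atTop] fun k => (N k : ℝ) ^ (β + δ) := by
  refine (isTheta_iff_exists_bounds (.of_forall fun k => by positivity)
    (.of_forall fun k => by positivity)).2 ?_
  obtain ⟨r, R, hr, _, hout⟩ := hD.exists_outSize_bounds hδ hN hrep
  obtain ⟨_, b, _, hb, hD⟩ := hD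
  refine ⟨r, max b R, hr, lt_max_of_lt_left hb, ?_⟩
  filter_upwards [hout, hD, hN.eventually_ge_atTop 1] with k hout hD hk
  obtain ⟨i⟩ := (D k).nonempty_groups hk
  have hk' : (1 : ℝ) ≤ N k := by exact_mod_cast hk
  refine ⟨(hout i).1.trans (by exact_mod_cast (D k).outSize_le_interactionSize i),
    Division.interactionSize_le (by positivity) (fun i => ?_) fun i => ?_⟩
  · refine (hD i).2.1.trans ?_
    gcongr
    · exact le_max_left _ _
    · exact le_add_of_nonneg_right hδ
  · refine (hout i).2.trans ?_
    gcongr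
    exact le_max_right _ _

theorem HasGroupExponent.isLittleO_interactionSize_iff (hδ : 0 ≤ δ) (hN : Tendsto N atTop atTop)
    (hrep : HasReplicationExponent N M δ) (hD : HasGroupExponent D β) :
    ((fun k => (M k : ℝ) ^ 2 / (N k : ℝ) ^ 2) =o[atTop] fun k => ((D k).interactionSize : ℝ)) ↔
      δ < β := by
  have hN' : Tendsto (fun k => (N k : ℝ)) atTop atTop := tendsto_natCast_atTop_atTop.comp hN
  rw [(hrep.sq_div_sq_isTheta hδ hN).isLittleO_congr_left,
    (hD.interactionSize_isTheta hδ hN hrep).isLittleO_congr_right, rpow_isLittleO_rpow_iff hN',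
    two_mul, add_lt_add_iff_right]

theorem HasGroupExponent.interactionSize_isBigO {ε : ℝ} (hδ : 0 ≤ δ) (hN : Tendsto N atTop atTop)
    (hrep : HasReplicationExponent N M δ) (hD : HasGroupExponent D β) (hβ : β ≤ δ + ε) :
    (fun k => ((D k).interactionSize : ℝ)) =O[atTop]
      fun k => (M k : ℝ) ^ 2 / (N k : ℝ) ^ (2 - ε) := by
  have hN' : Tendsto (fun k => (N k : ℝ)) atTop atTop := tendsto_natCast_atTop_atTop.comp hN
  calc (fun k => ((D k).interactionSize : ℝ))
      =O[atTop] fun k => (N k : ℝ) ^ (β + δ) := (hD.interactionSize_isTheta hδ hN hrep).1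
    _ =O[atTop] fun k => (N k : ℝ) ^ (2 * δ + ε) := rpow_isBigO_rpow hN' (by linarith)
    _ =ᶠ[atTop] fun k => (N k : ℝ) ^ (2 * δ) * (N k : ℝ) ^ ε := by
        filter_upwards [hN'.eventually_gt_atTop 0] with k hk
        exact Real.rpow_add hk _ _
    _ =O[atTop] fun k => (M k : ℝ) ^ 2 / (N k : ℝ) ^ 2 * (N k : ℝ) ^ ε :=
        (hrep.sq_div_sq_isTheta hδ hN).2.mul (isBigO_refl _ _)
    _ =ᶠ[atTop] fun k => (M k : ℝ) ^ 2 / (N k : ℝ) ^ (2 - ε) := by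
        filter_upwards [hN'.eventually_gt_atTop 0] with k hk
        rw [Real.rpow_sub hk, Real.rpow_two, div_div_eq_mul_div, div_mul_eq_mul_div]

/-- Part `i` of a division of `n` objects into `g` parts whose sizes differ by at most `1`. -/
def balancedSize (n g : ℕ) (i : Fin g) : ℕ := n / g + if (i : ℕ) < n % g then 1 else 0

theorem sum_balancedSize (n : ℕ) {g : ℕ} (hg : 0 < g) : ∑ i, balancedSize n g i = n := by
  have hcard : ∑ i : Fin g, (if (i : ℕ) < n % g then 1 else 0) = n % g := by
    rw [Finset.sum_boole, Fin.card_filter_val_lt, Nat.cast_id, min_eq_right (Nat.mod_lt n hg).le]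
  simp only [balancedSize, Finset.sum_add_distrib, Finset.sum_const, Finset.card_univ,
    Fintype.card_fin, smul_eq_mul, hcard, Nat.div_add_mod]

theorem balancedSize_bounds {n g : ℕ} (hg : 0 < g) (hgn : g ≤ n) (i : Fin g) :
    (n : ℝ) / g / 2 ≤ balancedSize n g i ∧ (balancedSize n g i : ℝ) ≤ 2 * (n / g) := by
  have hquot : ((n / g : ℕ) : ℝ) ≤ n / g := Nat.cast_div_le
  have hquot' : (n : ℝ) / g ≤ (n / g : ℕ) + 1 := by
    rw [div_le_iff₀' (by positivity)]
    exact_mod_cast (Nat.lt_mul_div_succ n hg).le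
  have hone : (1 : ℝ) ≤ (n / g : ℕ) := by exact_mod_cast (Nat.one_le_div_iff hg).2 hgn
  have hlower : ((n / g : ℕ) : ℝ) ≤ balancedSize n g i := by
    exact_mod_cast Nat.le_add_right _ _
  have hupper : (balancedSize n g i : ℝ) ≤ (n / g : ℕ) + 1 := by
    rw [balancedSize]
    split_ifs <;> push_cast <;> linarith
  constructor <;> linarith

theorem balancedSize_ratio_bounds {n m g : ℕ} (hg : 0 < g) (hgn : g ≤ n) (hgm : g ≤ m)
    (i : Fin g) :
    1 / 4 * (balancedSize n g i * ((m : ℝ) / n)) ≤ balancedSize m g i ∧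
      (balancedSize m g i : ℝ) ≤ 4 * (balancedSize n g i * ((m : ℝ) / n)) := by
  have hn : (0 : ℝ) < n := by exact_mod_cast hg.trans_le hgn
  have hratio : (n : ℝ) / g * (m / n) = m / g := by field_simp
  have hscale := (balancedSize_bounds hg hgn i).imp
    (mul_le_mul_of_nonneg_right · (by positivity : (0 : ℝ) ≤ m / n))
    (mul_le_mul_of_nonneg_right · (by positivity : (0 : ℝ) ≤ m / n))
  rw [div_mul_eq_mul_div, mul_assoc, hratio] at hscale
  obtain ⟨hm, hm'⟩ := balancedSize_bounds hg hgm i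
  constructor <;> linarith [hscale.1, hscale.2]

/-- The division into `g` groups with input sizes, and output sizes, that differ by at most `1`. -/
def balancedDivision (N M : ℕ) {g : ℕ} (hg : 0 < g) : Division N M where
  groups := g
  inSize := balancedSize N g
  outSize := balancedSize M g
  sum_inSize := sum_balancedSize N hg
  sum_outSize := sum_balancedSize M hg

theorem exists_natCast_div_rpow_bounds {x : ℝ} (hx : 1 ≤ x) (hβ0 : 0 ≤ β) (hβ1 : β ≤ 1) :
    ∃ g : ℕ, 0 < g ∧ g ≤ x ∧ x ^ β ≤ x / g ∧ x / g ≤ 2 * x ^ β := by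
  have hy : 1 ≤ x ^ (1 - β) := Real.one_le_rpow hx (sub_nonneg.2 hβ1)
  have hyx : x ^ (1 - β) ≤ x := by
    simpa only [Real.rpow_one] using
      Real.rpow_le_rpow_of_exponent_le hx (sub_le_self 1 hβ0)
  have hmul : x ^ β * x ^ (1 - β) = x := by
    rw [← Real.rpow_add (by positivity), add_sub_cancel, Real.rpow_one]
  have hfloor := Nat.floor_le (zero_le_one.trans hy)
  have hg : 0 < ⌊x ^ (1 - β)⌋₊ := Nat.floor_pos.2 hy
  have hfloor' : x ^ (1 - β) ≤ 2 * ⌊x ^ (1 - β)⌋₊ := by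
    have hg' : (1 : ℝ) ≤ ⌊x ^ (1 - β)⌋₊ := by exact_mod_cast hg
    linarith [Nat.lt_floor_add_one (x ^ (1 - β))]
  refine ⟨_, hg, hfloor.trans hyx, ?_, ?_⟩
  · rw [le_div_iff₀ (by positivity)]
    calc x ^ β * ⌊x ^ (1 - β)⌋₊ ≤ x ^ β * x ^ (1 - β) := by gcongr
      _ = x := hmul
  · rw [div_le_iff₀ (by positivity)]
    calc x = x ^ β * x ^ (1 - β) := hmul.symm
      _ ≤ x ^ β * (2 * ⌊x ^ (1 - β)⌋₊) := by gcongr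
      _ = 2 * x ^ β * ⌊x ^ (1 - β)⌋₊ := by ring

theorem exists_division_hasGroupExponent (hN : Tendsto N atTop atTop)
    (hNM : ∀ᶠ k in atTop, N k ≤ M k) (hβ0 : 0 ≤ β) (hβ1 : β ≤ 1) :
    ∃ D : ∀ k, Division (N k) (M k), HasGroupExponent D β := by
  have hgroups (k : ℕ) : ∃ g : ℕ, 0 < g ∧ (1 ≤ N k →
      g ≤ N k ∧ (N k : ℝ) ^ β ≤ N k / g ∧ (N k : ℝ) / g ≤ 2 * (N k : ℝ) ^ β) := by
    by_cases hk : 1 ≤ N k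
    · obtain ⟨g, hg, hgN, hbounds⟩ :=
        exists_natCast_div_rpow_bounds (x := N k) (by exact_mod_cast hk) hβ0 hβ1
      exact ⟨g, hg, fun _ => ⟨by exact_mod_cast hgN, hbounds⟩⟩
    · exact ⟨1, one_pos, fun h => absurd h hk⟩
  choose g hg hgN using hgroups
  refine ⟨fun k => balancedDivision (N k) (M k) (hg k), 1 / 4, 4, by norm_num, by norm_num, ?_⟩
  filter_upwards [hN.eventually_ge_atTop 1, hNM] with k hk hle i
  obtain ⟨hgk, hlower, hupper⟩ := hgN k hk
  obtain ⟨hin, hin'⟩ := balancedSize_bounds (hg k) hgk i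
  have hpos : (0 : ℝ) ≤ (N k : ℝ) ^ β := by positivity
  exact ⟨(by linarith [hpos] : _ ≤ (balancedSize (N k) (g k) i : ℝ)),
    (by linarith [hpos] : (balancedSize (N k) (g k) i : ℝ) ≤ _),
    balancedSize_ratio_bounds (hg k) hgk (hgk.trans hle) i⟩

end Sizes

/-! ### Superreplication -/

section Superreplication

variable {d : Type*} [Fintype d] {N M : ℕ → ℕ} {β δ : ℝ} {D : ∀ k, Division (N k) (M k)}

theorem HasGroupExponent.exists_one_sub_exp_le_optimalFidelity (hD : HasGroupExponent D β)
    (hδ : 0 ≤ δ) (hN : Tendsto N atTop atTop) (hrep : HasReplicationExponent N M δ) (hβ : 0 < β)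
    (e : d → ℝ) {c : d → ℂ} (hc : ∑ x, Complex.normSq (c x) = 1) :
    ∃ A : ℝ, 0 < A ∧ ∀ᶠ k in atTop, ∀ i : Fin (D k).groups,
      1 - Fintype.card d * Real.exp (-(A * (N k : ℝ) ^ (β - δ))) ≤
        optimalFidelity e c ((D k).inSize i) ((D k).outSize i) := by
  obtain ⟨κ, hκ, n₀, hfid⟩ := exists_le_optimalFidelity e hc
  obtain ⟨a, _, ha, _, hratio⟩ := hD.exists_inSize_sq_div_outSize_bounds hδ hN hrep
  refine ⟨κ * a, mul_pos hκ ha, ?_⟩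
  filter_upwards [hratio, hD.groupsGrowFasterThan_of_lt hN hβ n₀] with k hratio hlarge i
  have hn₀ : (n₀ : ℝ) ≤ (D k).inSize i := by
    simpa only [Real.rpow_zero, mul_one] using hlarge i
  refine le_trans ?_ (hfid _ _ (by exact_mod_cast hn₀))
  rw [mul_assoc]
  gcongr
  exact (hratio i).1

theorem HasGroupExponent.exists_optimalFidelity_le_one_sub (hD : HasGroupExponent D β)
    (hδ : 0 ≤ δ) (hN : Tendsto N atTop atTop) (hrep : HasReplicationExponent N M δ) (hβδ : β ≤ δ)
    {e : d → ℝ} {c : d → ℂ} (hc : ∑ x, Complex.normSq (c x) = 1)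
    (hne : ∃ x y, c x ≠ 0 ∧ c y ≠ 0 ∧ e x < e y) :
    ∃ η : ℝ, 0 < η ∧ ∀ᶠ k in atTop, ∃ i : Fin (D k).groups,
      optimalFidelity e c ((D k).inSize i) ((D k).outSize i) ≤ 1 - η := by
  obtain ⟨_, b, _, hb, hratio⟩ := hD.exists_inSize_sq_div_outSize_bounds hδ hN hrep
  obtain ⟨η, hη, hfid⟩ := Superreplication.exists_optimalFidelity_le_one_sub hc hne b
  refine ⟨η, hη, ?_⟩
  filter_upwards [hratio, hrep.1, hN.eventually_ge_atTop 1] with k hratio hNM hk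
  obtain ⟨i, hi⟩ := (D k).exists_inSize_lt_outSize hNM
  refine ⟨i, hfid _ _ hi ?_⟩
  have hm : (0 : ℝ) < (D k).outSize i := Nat.cast_pos.2 (Nat.zero_lt_of_lt hi)
  rw [← div_le_iff₀ hm]
  refine (hratio i).2.trans (mul_le_of_le_one_right hb.le ?_)
  exact Real.rpow_le_one_of_one_le_of_nonpos (by exact_mod_cast hk) (sub_nonpos.2 hβδ)

theorem HasGroupExponent.exists_groups_le (hD : HasGroupExponent D β) (hβ : 0 ≤ β)
    (hN : Tendsto N atTop atTop) :
    ∃ B : ℝ, 0 < B ∧ ∀ᶠ k in atTop, ((D k).groups : ℝ) ≤ B * N k := by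
  obtain ⟨a, _, ha, _, hD⟩ := hD
  refine ⟨a⁻¹, inv_pos.2 ha, ?_⟩
  filter_upwards [hD, hN.eventually_ge_atTop 1] with k hD hk
  have hone : 1 ≤ (N k : ℝ) ^ β := Real.one_le_rpow (by exact_mod_cast hk) hβ
  rw [le_inv_mul_iff₀' ha]
  calc ((D k).groups : ℝ) * a = ∑ _i : Fin (D k).groups, a := by
        rw [Finset.sum_const, Finset.card_univ, Fintype.card_fin, nsmul_eq_mul]
    _ ≤ ∑ i, ((D k).inSize i : ℝ) :=
        Finset.sum_le_sum fun i _ => (le_mul_of_one_le_right ha.le hone).trans (hD i).1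
    _ = N k := by exact_mod_cast (D k).sum_inSize

variable [DecidableEq d] {H : Matrix d d ℂ} {ψ : d → ℂ}

theorem one_sub_groups_mul_le_divideAndCloneFidelity {N M : ℕ} (D : Division N M)
    (C : ∀ i, ProbCloner H ψ (D.inSize i) (D.outSize i)) {ε : ℝ} (hε : ε ≤ 1)
    (h : ∀ i, 1 - ε ≤ fidelity H ψ (C i).op) :
    1 - D.groups * ε ≤ divideAndCloneFidelity D C :=
  calc 1 - D.groups * ε = 1 + D.groups * ((1 - ε) - 1) := by ring
    _ ≤ (1 - ε) ^ D.groups := one_add_mul_sub_le_pow (by linarith) _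
    _ = ∏ _i : Fin D.groups, (1 - ε) := by
        rw [Finset.prod_const, Finset.card_univ, Fintype.card_fin]
    _ ≤ ∏ i, fidelity H ψ (C i).op :=
        Finset.prod_le_prod (fun _ _ => sub_nonneg.2 hε) fun i _ => h i
    _ ≤ divideAndCloneFidelity D C := prod_fidelity_le_divideAndCloneFidelity D C

theorem HasGroupExponent.tendsto_divideAndCloneFidelity (hD : HasGroupExponent D β)
    (hH : H.IsHermitian) (hψ : star ψ ⬝ᵥ ψ = 1) (hδ : 0 ≤ δ) (hN : Tendsto N atTop atTop)
    (hrep : HasReplicationExponent N M δ) (hβ : δ < β)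
    {C : ∀ k i, ProbCloner H ψ ((D k).inSize i) ((D k).outSize i)}
    (hC : ∀ k i, (C k i).IsOptimal) :
    Tendsto (fun k => divideAndCloneFidelity (D k) (C k)) atTop (nhds 1) := by
  have hN' : Tendsto (fun k => (N k : ℝ)) atTop atTop := tendsto_natCast_atTop_atTop.comp hN
  have hψ0 : ψ ≠ 0 := by
    rintro rfl
    exact zero_ne_one ((dotProduct_zero _).symm.trans hψ)
  obtain ⟨A, hA, hfid⟩ := hD.exists_one_sub_exp_le_optimalFidelity hδ hN hrep (hδ.trans_lt hβ)
    hH.eigenvalues (sum_normSq_energyAmplitude hH hψ)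
  obtain ⟨B, _, hgroups⟩ := hD.exists_groups_le (hδ.trans hβ.le) hN
  set ε : ℕ → ℝ := fun k => Fintype.card d * Real.exp (-(A * (N k : ℝ) ^ (β - δ))) with hε
  have hεlim : Tendsto ε atTop (nhds 0) := by
    simpa only [Real.rpow_zero, one_mul, mul_zero] using
      (tendsto_rpow_mul_exp_neg_mul_rpow hN' 0 hA (sub_pos.2 hβ)).const_mul (Fintype.card d : ℝ)
  have hNεlim : Tendsto (fun k => 1 - B * N k * ε k) atTop (nhds 1) := by
    have hlim := (tendsto_rpow_mul_exp_neg_mul_rpow hN' 1 hA (sub_pos.2 hβ)).const_mul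
      (B * Fintype.card d)
    simp only [Real.rpow_one, mul_zero] at hlim
    simpa only [sub_zero] using (hlim.congr fun k => by rw [hε]; ring).const_sub 1
  refine tendsto_of_tendsto_of_tendsto_of_le_of_le' hNεlim tendsto_const_nhds ?_
    (.of_forall fun k => divideAndCloneFidelity_le_one hH (D k) (C k) hψ)
  filter_upwards [hfid, hgroups, hεlim.eventually_le_const one_pos] with k hfid hgroups hεk
  calc 1 - B * N k * ε k ≤ 1 - (D k).groups * ε k := by gcongr
    _ ≤ divideAndCloneFidelity (D k) (C k) :=
        one_sub_groups_mul_le_divideAndCloneFidelity (D k) (C k) hεk fun i =>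
          (hfid i).trans_eq ((hC k i).fidelity_eq hH hψ0).symm

theorem HasGroupExponent.lt_of_tendsto_divideAndCloneFidelity (hD : HasGroupExponent D β)
    (hH : H.IsHermitian) (hψ : star ψ ⬝ᵥ ψ = 1) (hclock : ∀ e : ℂ, H *ᵥ ψ ≠ e • ψ) (hδ : 0 ≤ δ)
    (hN : Tendsto N atTop atTop) (hrep : HasReplicationExponent N M δ)
    {C : ∀ k i, ProbCloner H ψ ((D k).inSize i) ((D k).outSize i)}
    (h : Tendsto (fun k => divideAndCloneFidelity (D k) (C k)) atTop (nhds 1)) : δ < β := by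
  by_contra! hβδ
  obtain ⟨η, hη, hfid⟩ := hD.exists_optimalFidelity_le_one_sub hδ hN hrep hβδ
    (sum_normSq_energyAmplitude hH hψ) (exists_eigenvalues_lt_of_forall_mulVec_ne_smul hH hclock)
  have hbound : ∀ᶠ k in atTop, divideAndCloneFidelity (D k) (C k) ≤ 1 - η := by
    filter_upwards [hfid] with k ⟨i, hi⟩
    exact (divideAndCloneFidelity_le_fidelity hH (D k) (C k) hψ i).trans
      (((C k i).fidelity_le_optimalFidelity hH).trans hi)
  linarith [le_of_tendsto h hbound]

end Superreplication

end Superreplication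

theorem mainTheorem6 {d : Type*} [Fintype d] [DecidableEq d]
    (H : Matrix d d ℂ) (hH : H.IsHermitian)
    (ψ : d → ℂ) (hψ : star ψ ⬝ᵥ ψ = 1)
    (hclock : ∀ e : ℂ, H *ᵥ ψ ≠ e • ψ) :
    -- optimal probabilistic cloners exist
    (∀ n m : ℕ, ∃ C : ProbCloner H ψ n m, C.IsOptimal) ∧
    ∀ (N M : ℕ → ℕ) (δ : ℝ), 0 ≤ δ → Tendsto N atTop atTop → HasReplicationExponent N M δ →
      -- exactly the groups that are large compared to `N ^ δ` give superreplication
      (∀ (β : ℝ) (D : ∀ k, Division (N k) (M k)), HasGroupExponent D β →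
        ∀ C : ∀ k i, ProbCloner H ψ ((D k).inSize i) ((D k).outSize i),
          (∀ k i, (C k i).IsOptimal) →
          List.TFAE [
            Tendsto (fun k => divideAndCloneFidelity (D k) (C k)) atTop (nhds 1),
            GroupsGrowFasterThan D δ,
            δ < β,
            (fun k => (M k : ℝ) ^ 2 / (N k : ℝ) ^ 2) =o[atTop]
              fun k => ((D k).interactionSize : ℝ)]) ∧
      -- interactions among `O(M ^ 2 / N ^ (2 - ε))` particles are enough
      (δ < 1 → ∀ ε : ℝ, 0 < ε →
        ∃ (β : ℝ) (D : ∀ k, Division (N k) (M k)), HasGroupExponent D β ∧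
          (fun k => ((D k).interactionSize : ℝ)) =O[atTop]
            (fun k => (M k : ℝ) ^ 2 / (N k : ℝ) ^ (2 - ε)) ∧
          ∀ C : ∀ k i, ProbCloner H ψ ((D k).inSize i) ((D k).outSize i),
            (∀ k i, (C k i).IsOptimal) →
            Tendsto (fun k => divideAndCloneFidelity (D k) (C k)) atTop (nhds 1)) := by
  have hψ0 : ψ ≠ 0 := by
    rintro rfl
    exact zero_ne_one ((dotProduct_zero _).symm.trans hψ)
  refine ⟨exists_isOptimal hH hψ0, fun N M δ hδ hN hrep => ⟨fun β D hD C hC => ?_, ?_⟩⟩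
  · tfae_have 1 → 3 := hD.lt_of_tendsto_divideAndCloneFidelity hH hψ hclock hδ hN hrep
    tfae_have 3 → 1 := fun hβ => hD.tendsto_divideAndCloneFidelity hH hψ hδ hN hrep hβ hC
    tfae_have 2 → 3 := hD.lt_of_groupsGrowFasterThan hN
    tfae_have 3 → 2 := hD.groupsGrowFasterThan_of_lt hN
    tfae_have 4 ↔ 3 := hD.isLittleO_interactionSize_iff hδ hN hrep
    tfae_finish
  · intro hδ1 ε hε
    obtain ⟨β, hβ, hβε, hβ1⟩ : ∃ β, δ < β ∧ β ≤ δ + ε ∧ β ≤ 1 :=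
      ⟨min (δ + ε) 1, lt_min (by linarith) hδ1, min_le_left _ _, min_le_right _ _⟩
    obtain ⟨D, hD⟩ := exists_division_hasGroupExponent hN
      (hrep.1.mono fun _ => le_of_lt) (hδ.trans hβ.le) hβ1
    exact ⟨β, D, hD, hD.interactionSize_isBigO hδ hN hrep hβε, fun C hC =>
      hD.tendsto_divideAndCloneFidelity hH hψ hδ hN hrep hβ hC⟩
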